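/- Let $n\ge 1$ and let $\mathcal A=\{\alpha_1,\dots,\alpha_{n+3}\}\subset\mathbb R^n$ be a near-circuit, i.e. a set of $n+3$ distinct points not contained in an affine hyperplane. Let $\widehat{\mathcal A}\in\mathbb R^{(n+1)\times(n+3)}$ be the matrix with columns $(1,\alpha_i)^\top$, let $B\in\mathbb R^{(n+3)\times 2}$ be a Gale dual matrix of $\mathcal A$ (its columns form a basis of $\ker\widehat{\mathcal A}$), and let $\varepsilon\in\{\pm1\}^{n+3}$. Let $\nabla_{\mathcal A,\varepsilon}$ be the set of $c\in\mathbb R^{n+3}$ with $\operatorname{sign}(c)=\varepsilon$ for which $f_c(x)=\sum_i c_i e^{\alpha_i\cdot x}$ has a real zero at which all its first partial derivatives vanish. The signed reduced $\mathcal A$-discriminant curve is $\Gamma=\{B^\top\mathrm{Log}|c| : c\in\nabla_{\mathcal A,\varepsilon}\}\subset\mathbb R^2$. It is the image of the cone $C=\{\lambda\in\mathbb R^2:\operatorname{sign}(B\lambda)=\varepsilon\}$ under $\xi(\lambda)=B^\top\mathrm{Log}|B\lambda|$, and $\xi$ is constant along rays; a cusp of $\Gamma$ is a ray of $C$ along which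 the differential of $\xi$ vanishes. A chamber is a connected component of $\mathbb R^2\setminus\Gamma$; it is called inner if it is bounded and outer if it is unbounded. The depth of a chamber is the minimum number of intersections with $\Gamma$ of a path that runs from a point of the chamber to a point of an outer chamber and meets $\Gamma$ transversally (in particular not at cusps), where an intersection at a point lying on several branches of $\Gamma$ is counted once for each branch. Two distinct chambers are adjacent if their common boundary contains an arc of $\Gamma$. Suppose that $\Gamma$ has exactly $m$ cusps. Then: 1. Every chamber has depth at most $\lfloor m/2\rfloor$. 2. If $m\in\{2,3\}$, then every inner chamber has depth $1$. 3. If $m=4$, then every chamber has depth at most $2$, and every chamber adjacent to a chamber of depth $2$ has depth $1$ (in particular, no two chambers of depth $2$ are adjacent). -/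

import Mathlib

open scoped Matrix

namespace NearCircuit

noncomputable section

/-- A family of exponent vectors is a near-circuit if it consists of `n + 3` distinct points
of `ℝⁿ` that do not lie in an affine hyperplane. -/
def IsNearCircuit {n : ℕ} (A : Fin (n + 3) → Fin n → ℝ) : Prop :=
  Function.Injective A ∧ affineSpan ℝ (Set.range A) = ⊤

/-- The matrix `Â` with top row `(1, …, 1)` and the exponent vectors below it as columns. -/
def hat {n : ℕ} (A : Fin (n + 3) → Fin n → ℝ) : Matrix (Fin (n + 1)) (Fin (n + 3)) ℝ :=
  Matrix.of fun r i => (Fin.cons 1 (A i) : Fin (n + 1) → ℝ) r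

/-- `B` is a Gale dual matrix of `A`: its columns form a basis of `ker Â`. -/
def IsGaleDual {n : ℕ} (A : Fin (n + 3) → Fin n → ℝ) (B : Matrix (Fin (n + 3)) (Fin 2) ℝ) :
    Prop :=
  LinearIndependent ℝ (fun j : Fin 2 => B.col j) ∧
    Submodule.span ℝ (Set.range fun j : Fin 2 => B.col j) = LinearMap.ker (hat A).mulVecLin

/-- The exponential sum `f_c(x) = ∑ᵢ cᵢ exp(αᵢ · x)`. -/
def expSum {n : ℕ} (A : Fin (n + 3) → Fin n → ℝ) (c : Fin (n + 3) → ℝ) (x : Fin n → ℝ) : ℝ :=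
  ∑ i, c i * Real.exp (A i ⬝ᵥ x)

/-- `x` is a singular zero of `f`: `f` and all its first partial derivatives vanish at `x`. -/
def IsSingularZero {n : ℕ} (f : (Fin n → ℝ) → ℝ) (x : Fin n → ℝ) : Prop :=
  f x = 0 ∧ ∀ j, fderiv ℝ f x (Pi.single j 1) = 0

/-- The open orthant of sign vector `ε`. -/
def orthant {N : ℕ} (ε : Fin N → SignType) : Set (Fin N → ℝ) :=
  {c | ∀ i, SignType.sign (c i) = ε i}

/-- The signed `A`-discriminant variety. -/
def discriminant {n : ℕ} (A : Fin (n + 3) → Fin n → ℝ) (ε : Fin (n + 3) → SignType) :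
    Set (Fin (n + 3) → ℝ) :=
  {c | c ∈ orthant ε ∧ ∃ x, IsSingularZero (expSum A c) x}

/-- The map `c ↦ Bᵀ Log|c|`. -/
def logMap {N : ℕ} (B : Matrix (Fin N) (Fin 2) ℝ) (c : Fin N → ℝ) : Fin 2 → ℝ :=
  Bᵀ *ᵥ fun i => Real.log |c i|

/-- The signed reduced `A`-discriminant curve `Γ_ε(A, B) = Bᵀ Log|∇_{A,ε}|`. -/
def curve {n : ℕ} (A : Fin (n + 3) → Fin n → ℝ) (B : Matrix (Fin (n + 3)) (Fin 2) ℝ)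
    (ε : Fin (n + 3) → SignType) : Set (Fin 2 → ℝ) :=
  logMap B '' discriminant A ε

/-- The cone `C_{B,ε}` of parameters `l` with `B l` in the orthant of `ε`. -/
def cone {N : ℕ} (B : Matrix (Fin N) (Fin 2) ℝ) (ε : Fin N → SignType) : Set (Fin 2 → ℝ) :=
  {l | B *ᵥ l ∈ orthant ε}

/-- The Horn–Kapranov map `ξ(l) = Bᵀ Log|B l|`. -/
def xi {N : ℕ} (B : Matrix (Fin N) (Fin 2) ℝ) (l : Fin 2 → ℝ) : Fin 2 → ℝ :=
  logMap B (B *ᵥ l)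

/-- For a Gale dual matrix the Horn–Kapranov map is constant along rays, so the curve is really
parametrized by the rays of the cone. Every ray of the cone contains exactly one point `l` with
`∑ᵢ |(B l)ᵢ| = 1`, which we use to represent it; these points form an open line segment. -/
def params {N : ℕ} (B : Matrix (Fin N) (Fin 2) ℝ) (ε : Fin N → SignType) : Set (Fin 2 → ℝ) :=
  {l | l ∈ cone B ε ∧ ∑ i, |(B *ᵥ l) i| = 1}

/-- The cusps, as parameters (one for each ray): the points where the differential of `ξ`
vanishes. The derivative of `ξ` along the ray is always zero, so this says that the derivative
of `ξ` in any one direction transverse to the ray is zero. -/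
def cusps {N : ℕ} (B : Matrix (Fin N) (Fin 2) ℝ) (ε : Fin N → SignType) : Set (Fin 2 → ℝ) :=
  {l | l ∈ params B ε ∧ fderiv ℝ (xi B) l = 0}

/-- A chamber is a connected component of the complement of the curve. -/
def IsChamber (Γ C : Set (Fin 2 → ℝ)) : Prop :=
  ∃ p ∈ Γᶜ, C = connectedComponentIn Γᶜ p

/-- Outer chambers are the unbounded ones. -/
def IsOuter (Γ C : Set (Fin 2 → ℝ)) : Prop :=
  IsChamber Γ C ∧ ¬ Bornology.IsBounded C

/-- Inner chambers are the bounded ones. -/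
def IsInner (Γ C : Set (Fin 2 → ℝ)) : Prop :=
  IsChamber Γ C ∧ Bornology.IsBounded C

/-- The intersections of a path `a : [0, 1] → ℝ²` with the parametrized curve: pairs of a time and
a curve parameter with the same image. A passage through a point where two branches of the
curve meet thus counts once for each branch. -/
def crossings {N : ℕ} (B : Matrix (Fin N) (Fin 2) ℝ) (ε : Fin N → SignType)
    (a : ℝ → Fin 2 → ℝ) : Set (ℝ × (Fin 2 → ℝ)) :=
  {q | q.1 ∈ Set.Icc (0 : ℝ) 1 ∧ q.2 ∈ params B ε ∧ a q.1 = xi B q.2}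

/-- A path meets the curve transversally if at each intersection it has a velocity vector which
together with the image of the differential of `ξ` spans the plane. In particular it
does not pass through cusps. -/
def IsTransversalPath {N : ℕ} (B : Matrix (Fin N) (Fin 2) ℝ) (ε : Fin N → SignType)
    (a : ℝ → Fin 2 → ℝ) : Prop :=
  ContinuousOn a (Set.Icc 0 1) ∧
    ∀ q ∈ crossings B ε a, ∃ v : Fin 2 → ℝ, HasDerivAt a v q.1 ∧
      Submodule.span ℝ {v} ⊔ LinearMap.range (fderiv ℝ (xi B) q.2).toLinearMap = ⊤

/-- The depth of `C`: the minimum number of intersections with the curve of a transversal path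
from a point of `C` to a point of an outer chamber (`⊤` if there is no such path). -/
def depth {n : ℕ} (A : Fin (n + 3) → Fin n → ℝ) (B : Matrix (Fin (n + 3)) (Fin 2) ℝ)
    (ε : Fin (n + 3) → SignType) (C : Set (Fin 2 → ℝ)) : ℕ∞ :=
  ⨅ (a : ℝ → Fin 2 → ℝ) (_ : IsTransversalPath B ε a) (_ : a 0 ∈ C)
    (_ : ∃ D, IsOuter (curve A B ε) D ∧ a 1 ∈ D), (crossings B ε a).encard

/-- Two different chambers are adjacent if their common boundary contains an arc of the curve,
i.e. the image of a nonempty open set of parameters. -/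
def Adjacent {N : ℕ} (B : Matrix (Fin N) (Fin 2) ℝ) (ε : Fin N → SignType)
    (C D : Set (Fin 2 → ℝ)) : Prop :=
  C ≠ D ∧ ∃ V : Set (Fin 2 → ℝ), IsOpen V ∧ V.Nonempty ∧ V ⊆ cone B ε ∧
    xi B '' V ⊆ frontier C ∩ frontier D

end

end NearCircuit

/-!
The curve `Γ` is the image under the Horn–Kapranov map `ξ` of an open segment of parameters
`l = p + t v`. The Jacobian matrix of `ξ` at `l` is symmetric and kills `l`, so the velocity of `Γ`
at the parameter `t` is `h(t)` times the rotated vector `rot l`: the curve has normal vector `l`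
there, its normals turn monotonically, and its cusps are the zeros of `h`.

The derivative of the linear function `cross d` along `Γ` is therefore `h(t) (d · l)`, which
vanishes at the cusps and where `d` is orthogonal to `l`. Fix a cusp `τ`, and choose `d` so that
`d · l` has no zero if `h` keeps its sign at `τ`, and vanishes exactly at `τ` if `h` changes sign
there. In both cases the derivative vanishes only at cusps and keeps its sign at `τ`, so that
between two consecutive intersections of `Γ` with a line of direction `d` there is, by Rolle's
theorem, a cusp other than `τ`. Hence such a line meets `Γ` at most `max m 1` times. One of the
two half-lines from a point of a chamber has at most half of these intersections, which bounds the
depth. If two chambers are adjacent, a generic line through their common arc contains points of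
both that are separated by a single intersection, so that their depths and `1` add up to at most
`max m 1`.
-/

namespace NearCircuit

open Set Filter Topology

section RealFunctions

theorem encard_level_le_card_add_one {α β : Type*} [LinearOrder α] {s : Set α} {f : α → β}
    (Z : Finset α) (hf : ∀ x ∈ s, ∀ y ∈ s, x < y → f x = f y → ∃ z ∈ Z, x < z ∧ z < y) (c : β) :
    {t | t ∈ s ∧ f t = c}.encard ≤ Z.card + 1 := by
  by_contra! hlt
  obtain ⟨T, hTs, hT⟩ := exists_subset_encard_eq (Order.add_one_le_of_lt hlt)
  have hfin : T.Finite := finite_of_encard_eq_coe (k := Z.card + 1 + 1) (by exact_mod_cast hT)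
  have hle : hfin.toFinset.card ≤ Z.card + 1 := by
    refine Finset.card_le_of_interleaved fun x hx y hy hxy _ => ?_
    obtain ⟨hxs, hxc⟩ := hTs (hfin.mem_toFinset.mp hx)
    obtain ⟨hys, hyc⟩ := hTs (hfin.mem_toFinset.mp hy)
    exact hf x hxs y hys hxy (hxc.trans hyc.symm)
  rw [hfin.encard_eq_coe_toFinset_card] at hT
  norm_cast at hT
  omega

variable {f f' : ℝ → ℝ}

theorem injOn_of_hasDerivAt_ne_zero {s : Set ℝ} (hs : s.OrdConnected)
    (hf : ∀ t ∈ s, HasDerivAt f (f' t) t) (hf' : ∀ t ∈ s, f' t ≠ 0) : InjOn f s := by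
  have key : ∀ x ∈ s, ∀ y ∈ s, x < y → f x ≠ f y := by
    intro x hx y hy hxy he
    have hsub : Icc x y ⊆ s := hs.out hx hy
    obtain ⟨z, hz, hz0⟩ := exists_hasDerivAt_eq_zero hxy
      (fun t ht => (hf t (hsub ht)).continuousAt.continuousWithinAt) he
      (fun t ht => hf t (hsub (Ioo_subset_Icc_self ht)))
    exact hf' z (hsub (Ioo_subset_Icc_self hz)) hz0
  intro x hx y hy he
  by_contra hne
  rcases lt_or_gt_of_ne hne with hlt | hlt
  · exact key x hx y hy hlt he
  · exact key y hy x hx hlt he.symm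

theorem strictMonoOn_or_strictAntiOn_of_hasDerivAt_ne_zero {x y : ℝ}
    (hf : ∀ t ∈ Icc x y, HasDerivAt f (f' t) t) (hf' : ∀ t ∈ Ioo x y, f' t ≠ 0) :
    (StrictMonoOn f (Icc x y) ∧ ∀ t ∈ Ioo x y, 0 < f' t) ∨
      (StrictAntiOn f (Icc x y) ∧ ∀ t ∈ Ioo x y, f' t < 0) := by
  have hcont : ContinuousOn f (Icc x y) := fun t ht => (hf t ht).continuousAt.continuousWithinAt
  have hderiv : ∀ t ∈ Ioo x y, HasDerivWithinAt f (f' t) (Ioo x y) t := fun t ht =>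
    (hf t (Ioo_subset_Icc_self ht)).hasDerivWithinAt
  rcases hasDerivWithinAt_forall_lt_or_forall_gt_of_forall_ne (convex_Ioo x y) hderiv hf'
    with hneg | hpos
  · exact Or.inr ⟨strictAntiOn_of_hasDerivWithinAt_neg (convex_Icc x y) hcont
      (by rwa [interior_Icc]) (by rwa [interior_Icc]), hneg⟩
  · exact Or.inl ⟨strictMonoOn_of_hasDerivWithinAt_pos (convex_Icc x y) hcont
      (by rwa [interior_Icc]) (by rwa [interior_Icc]), hpos⟩

-- If `τ` were the only zero, `f` would be strictly monotone in the same sense on both sides of it.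
theorem exists_hasDerivAt_eq_zero_ne {x y τ : ℝ} (hxy : x < y)
    (hf : ∀ t ∈ Icc x y, HasDerivAt f (f' t) t)
    (hτ : ∀ᶠ u in 𝓝[<] τ, ∀ᶠ w in 𝓝[>] τ, 0 < f' u * f' w) (h : f x = f y) :
    ∃ z ∈ Ioo x y, z ≠ τ ∧ f' z = 0 := by
  by_contra! hne
  have hmem : τ ∈ Ioo x y := by
    obtain ⟨z, hz, hz0⟩ := exists_hasDerivAt_eq_zero hxy
      (fun t ht => (hf t ht).continuousAt.continuousWithinAt) h
      (fun t ht => hf t (Ioo_subset_Icc_self ht))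
    by_contra hnot
    exact hne z hz (fun e => hnot (e ▸ hz)) hz0
  obtain ⟨u, hu, w, hw, huw⟩ : ∃ u ∈ Ioo x τ, ∃ w ∈ Ioo τ y, 0 < f' u * f' w := by
    obtain ⟨u, hw, hu⟩ := (hτ.and (Ioo_mem_nhdsLT hmem.1)).exists
    obtain ⟨w, huw, hw⟩ := (hw.and (Ioo_mem_nhdsGT hmem.2)).exists
    exact ⟨u, hu, w, hw, huw⟩
  have hleft : x ∈ Icc x τ ∧ τ ∈ Icc x τ := by simp [hmem.1.le]
  have hright : τ ∈ Icc τ y ∧ y ∈ Icc τ y := by simp [hmem.2.le]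
  rcases strictMonoOn_or_strictAntiOn_of_hasDerivAt_ne_zero
      (fun t ht => hf t (Icc_subset_Icc_right hmem.2.le ht))
      (fun t ht => hne t (Ioo_subset_Ioo_right hmem.2.le ht) ht.2.ne) with ⟨hl, hl'⟩ | ⟨hl, hl'⟩ <;>
    rcases strictMonoOn_or_strictAntiOn_of_hasDerivAt_ne_zero
      (fun t ht => hf t (Icc_subset_Icc_left hmem.1.le ht))
      (fun t ht => hne t (Ioo_subset_Ioo_left hmem.1.le ht) ht.1.ne') with ⟨hr, hr'⟩ | ⟨hr, hr'⟩
  · exact (hl hleft.1 hleft.2 hmem.1).trans (hr hright.1 hright.2 hmem.2) |>.ne h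
  · exact (mul_neg_of_pos_of_neg (hl' u hu) (hr' w hw)).not_gt huw
  · exact (mul_neg_of_neg_of_pos (hl' u hu) (hr' w hw)).not_gt huw
  · exact (hr hright.1 hright.2 hmem.2).trans (hl hleft.1 hleft.2 hmem.1) |>.ne h.symm

theorem eventually_mul_pos_or_eventually_mul_neg {τ : ℝ}
    (hf : ∀ᶠ t in 𝓝[≠] τ, HasDerivAt f (f' t) t) (hf' : ∀ᶠ t in 𝓝[≠] τ, f' t ≠ 0) :
    (∀ᶠ u in 𝓝[<] τ, ∀ᶠ w in 𝓝[>] τ, 0 < f' u * f' w) ∨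
      (∀ᶠ u in 𝓝[<] τ, ∀ᶠ w in 𝓝[>] τ, f' u * f' w < 0) := by
  have sign_of_Ioo : ∀ {x y : ℝ}, (∀ t ∈ Ioo x y, HasDerivAt f (f' t) t ∧ f' t ≠ 0) →
      (∀ t ∈ Ioo x y, f' t < 0) ∨ ∀ t ∈ Ioo x y, 0 < f' t := fun {x y} H =>
    hasDerivWithinAt_forall_lt_or_forall_gt_of_forall_ne (convex_Ioo x y)
      (fun t ht => (H t ht).1.hasDerivWithinAt) fun t ht => (H t ht).2
  obtain ⟨x, hxτ, hx⟩ := mem_nhdsLT_iff_exists_Ioo_subset.mp (nhdsLT_le_nhdsNE τ (hf.and hf'))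
  obtain ⟨y, hτy, hy⟩ := mem_nhdsGT_iff_exists_Ioo_subset.mp (nhdsGT_le_nhdsNE τ (hf.and hf'))
  have hl : Ioo x τ ∈ 𝓝[<] τ := Ioo_mem_nhdsLT hxτ
  have hr : Ioo τ y ∈ 𝓝[>] τ := Ioo_mem_nhdsGT hτy
  rcases sign_of_Ioo hx with hl' | hl' <;> rcases sign_of_Ioo hy with hr' | hr'
  · exact Or.inl <| mem_of_superset hl fun u hu => mem_of_superset hr fun w hw =>
      mul_pos_of_neg_of_neg (hl' u hu) (hr' w hw)
  · exact Or.inr <| mem_of_superset hl fun u hu => mem_of_superset hr fun w hw =>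
      mul_neg_of_neg_of_pos (hl' u hu) (hr' w hw)
  · exact Or.inr <| mem_of_superset hl fun u hu => mem_of_superset hr fun w hw =>
      mul_neg_of_pos_of_neg (hl' u hu) (hr' w hw)
  · exact Or.inl <| mem_of_superset hl fun u hu => mem_of_superset hr fun w hw =>
      mul_pos (hl' u hu) (hr' w hw)

theorem exists_tendsto_nhdsGT_of_hasDerivAt_ne_zero {a : ℝ}
    (hf : ∀ᶠ t in 𝓝[>] a, HasDerivAt f (f' t) t) (hf' : ∀ᶠ t in 𝓝[>] a, f' t ≠ 0) :
    ∃ l : EReal, Tendsto (fun t => (f t : EReal)) (𝓝[>] a) (𝓝 l) := by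
  obtain ⟨b, hab, hb⟩ := mem_nhdsGT_iff_exists_Ioo_subset.mp (hf.and hf')
  have hcont : ContinuousOn f (Ioo a b) := fun t ht =>
    (hb ht).1.continuousAt.continuousWithinAt
  have hinj : InjOn f (Ioo a b) := injOn_of_hasDerivAt_ne_zero ordConnected_Ioo
    (fun t ht => (hb ht).1) fun t ht => (hb ht).2
  have hne : (Ioo a b).Nonempty := nonempty_Ioo.mpr hab
  rcases hcont.strictMonoOn_of_injOn_Ioo hab hinj with hmono | hanti
  · exact ⟨_, MonotoneOn.tendsto_nhdsWithin_Ioo_right hne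
      (EReal.coe_strictMono.monotone.comp_monotoneOn hmono.monotoneOn) (OrderBot.bddBelow _)⟩
  · exact ⟨_, AntitoneOn.tendsto_nhdsWithin_Ioo_right hne
      (EReal.coe_strictMono.monotone.comp_antitoneOn hanti.antitoneOn) (OrderTop.bddAbove _)⟩

theorem exists_tendsto_nhdsLT_of_hasDerivAt_ne_zero {b : ℝ}
    (hf : ∀ᶠ t in 𝓝[<] b, HasDerivAt f (f' t) t) (hf' : ∀ᶠ t in 𝓝[<] b, f' t ≠ 0) :
    ∃ l : EReal, Tendsto (fun t => (f t : EReal)) (𝓝[<] b) (𝓝 l) := by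
  have hneg : Tendsto (fun t : ℝ => -t) (𝓝[>] (-b)) (𝓝[<] b) := by
    simpa using tendsto_neg_nhdsGT (a := -b)
  obtain ⟨l, hl⟩ := exists_tendsto_nhdsGT_of_hasDerivAt_ne_zero (a := -b)
    (f := fun t => f (-t)) (f' := fun t => -f' (-t))
    ((hneg.eventually hf).mono fun t ht => by
      simpa [Function.comp_def] using ht.comp_of_eq t (hasDerivAt_neg t) rfl)
    ((hneg.eventually hf').mono fun t ht => neg_ne_zero.mpr ht)
  exact ⟨l, by simpa [Function.comp_def] using hl.comp (tendsto_neg_nhdsLT (a := b))⟩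

theorem exists_eq_Ioo {s : Set ℝ} (hopen : IsOpen s) (hs : IsPreconnected s)
    (hbdd : Bornology.IsBounded s) : ∃ a b, s = Ioo a b := by
  rcases s.eq_empty_or_nonempty with rfl | hne
  · exact ⟨0, 0, (Ioo_self 0).symm⟩
  · refine ⟨sInf s, sSup s, Subset.antisymm ?_
      (IsConnected.Ioo_csInf_csSup_subset ⟨hne, hs⟩ hbdd.bddBelow hbdd.bddAbove)⟩
    rw [← interior_Icc]
    exact interior_maximal (subset_Icc_csInf_csSup hbdd.bddBelow hbdd.bddAbove) hopen

end RealFunctions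

section Plane

/-- The determinant of two vectors of the plane; for fixed `d ≠ 0` its values `cross d x` number
the lines of direction `d`. -/
def cross (x y : Fin 2 → ℝ) : ℝ := x 0 * y 1 - x 1 * y 0

/-- Rotation of the plane by a right angle. -/
def rot (x : Fin 2 → ℝ) : Fin 2 → ℝ := ![-x 1, x 0]

theorem cross_self (x : Fin 2 → ℝ) : cross x x = 0 := by
  simp only [cross]; ring

theorem cross_sub_right (x y z : Fin 2 → ℝ) : cross x (y - z) = cross x y - cross x z := by
  simp only [cross, Pi.sub_apply]; ring

theorem cross_smul_left (r : ℝ) (x y : Fin 2 → ℝ) : cross (r • x) y = r * cross x y := by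
  simp only [cross, Pi.smul_apply, smul_eq_mul]; ring

theorem cross_smul_right (r : ℝ) (x y : Fin 2 → ℝ) : cross x (r • y) = r * cross x y := by
  simp only [cross, Pi.smul_apply, smul_eq_mul]; ring

theorem cross_add_smul (d x : Fin 2 → ℝ) (s : ℝ) : cross d (x + s • d) = cross d x := by
  simp only [cross, Pi.add_apply, Pi.smul_apply, smul_eq_mul]; ring

theorem cross_rot (x y : Fin 2 → ℝ) : cross x (rot y) = x ⬝ᵥ y := by
  simp [cross, rot, dotProduct]

theorem rot_dotProduct (x y : Fin 2 → ℝ) : rot x ⬝ᵥ y = cross x y := by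
  simp only [cross, rot, dotProduct, Fin.sum_univ_two, Matrix.cons_val_zero, Matrix.cons_val_one]
  ring

theorem cross_add_smul_rot (d x : Fin 2 → ℝ) (u : ℝ) :
    cross d (x + u • rot d) = cross d x + u * (d ⬝ᵥ d) := by
  simp only [cross, rot, dotProduct, Fin.sum_univ_two, Pi.add_apply, Pi.smul_apply, smul_eq_mul,
    Matrix.cons_val_zero, Matrix.cons_val_one]
  ring

theorem dotProduct_self_pos {d : Fin 2 → ℝ} (hd : d ≠ 0) : 0 < d ⬝ᵥ d := by
  simpa using Matrix.dotProduct_star_self_pos_iff.mpr hd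

theorem continuous_cross (d : Fin 2 → ℝ) : Continuous (cross d) := by
  unfold cross; fun_prop

theorem add_smul_injective {d : Fin 2 → ℝ} (hd : d ≠ 0) (x : Fin 2 → ℝ) :
    Function.Injective fun s : ℝ => x + s • d :=
  (add_right_injective x).comp (smul_left_injective ℝ hd)

theorem eq_add_smul_add_smul_rot {d : Fin 2 → ℝ} (hd : d ≠ 0) (x y : Fin 2 → ℝ) :
    y = x + (d ⬝ᵥ (y - x) / (d ⬝ᵥ d)) • d + (cross d (y - x) / (d ⬝ᵥ d)) • rot d := by
  have hdd : d ⬝ᵥ d ≠ 0 := (dotProduct_self_pos hd).ne'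
  ext i
  apply mul_left_cancel₀ hdd
  simp only [Pi.add_apply, Pi.smul_apply, smul_eq_mul, mul_add, div_mul_eq_mul_div,
    mul_div_cancel₀ _ hdd]
  fin_cases i <;> simp [cross, rot, dotProduct] <;> ring

theorem exists_eq_add_smul_of_cross_eq {d : Fin 2 → ℝ} (hd : d ≠ 0) {x y : Fin 2 → ℝ}
    (h : cross d y = cross d x) : ∃ s : ℝ, y = x + s • d := by
  refine ⟨d ⬝ᵥ (y - x) / (d ⬝ᵥ d), (eq_add_smul_add_smul_rot hd x y).trans ?_⟩
  rw [cross_sub_right, h, sub_self, zero_div, zero_smul, add_zero]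

theorem cross_smul_eq (x y z : Fin 2 → ℝ) : cross x y • z = cross z y • x + cross x z • y := by
  ext i
  simp only [cross, Pi.add_apply, Pi.smul_apply, smul_eq_mul]
  fin_cases i <;> (simp only [Fin.zero_eta, Fin.mk_one]; ring)

theorem eq_dotProduct_smul_rot {l v w : Fin 2 → ℝ} (hlw : l ⬝ᵥ w = 0) (hlv : cross l v = 1) :
    w = (v ⬝ᵥ w) • rot l := by
  simp only [dotProduct, Fin.sum_univ_two, cross] at hlw hlv
  ext i
  fin_cases i <;> simp only [rot, dotProduct, Fin.sum_univ_two, Pi.smul_apply, smul_eq_mul,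
    Fin.zero_eta, Fin.mk_one, Matrix.cons_val_zero, Matrix.cons_val_one]
  · linear_combination v 1 * hlw - w 0 * hlv
  · linear_combination -v 0 * hlw - w 1 * hlv

theorem span_sup_span_eq_top_iff {x y : Fin 2 → ℝ} :
    Submodule.span ℝ {x} ⊔ Submodule.span ℝ {y} = ⊤ ↔ cross x y ≠ 0 := by
  rw [← Submodule.span_union, singleton_union, Submodule.eq_top_iff']
  simp only [Submodule.mem_span_pair]
  refine ⟨fun hspan h0 => ?_, fun hne z => ⟨cross z y / cross x y, cross x z / cross x y, ?_⟩⟩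
  · obtain ⟨a₀, b₀, h₀⟩ := hspan ![1, 0]
    obtain ⟨a₁, b₁, h₁⟩ := hspan ![0, 1]
    have hdet : (a₀ * b₁ - b₀ * a₁) * cross x y = cross ![1, 0] ![0, 1] := by
      rw [← h₀, ← h₁]
      simp only [cross, Pi.add_apply, Pi.smul_apply, smul_eq_mul]
      ring
    rw [h0, mul_zero] at hdet
    simp [cross] at hdet
  · apply smul_right_injective _ hne
    simp only [smul_add, smul_smul, mul_div_cancel₀ _ hne]
    exact (cross_smul_eq x y z).symm

theorem linearMap_eq_cross_smul {E : Type*} [AddCommGroup E] [Module ℝ E]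
    (L : (Fin 2 → ℝ) →ₗ[ℝ] E) {l v : Fin 2 → ℝ} (hl : L l = 0) (hlv : cross l v = 1)
    (w : Fin 2 → ℝ) : L w = cross l w • L v := by
  have h := congrArg L (cross_smul_eq l v w)
  simpa only [map_smul, map_add, hl, hlv, one_smul, smul_zero, zero_add] using h

end Plane

section Curves

/-- The points at which the curve `γ` on `(a, b)` accumulates as the parameter tends to one of the
ends of the interval. -/
def endLimits (a b : ℝ) (γ : ℝ → Fin 2 → ℝ) : Set (Fin 2 → ℝ) :=
  {y | MapClusterPt y (𝓝[>] a) γ ∨ MapClusterPt y (𝓝[<] b) γ}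

variable {a b : ℝ} {γ : ℝ → Fin 2 → ℝ}

theorem isClosed_endLimits : IsClosed (endLimits a b γ) :=
  isClosed_setOfPred_clusterPt.union isClosed_setOfPred_clusterPt

-- Parameters of points near `y` can only accumulate at parameters of `y` or at the ends.
theorem eventually_forall_param_mem (hγ : ContinuousOn γ (Ioo a b)) {y : Fin 2 → ℝ}
    (hy : y ∉ endLimits a b γ) {T : Set ℝ} (hT : IsOpen T)
    (hyT : ∀ t ∈ Ioo a b, γ t = y → t ∈ T) : ∀ᶠ z in 𝓝 y, ∀ t ∈ Ioo a b, γ t = z → t ∈ T := by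
  have hcluster : ¬ MapClusterPt y (𝓟 (Ioo a b \ T)) γ := by
    rw [mapClusterPt_iff_ultrafilter]
    rintro ⟨U, hU, hUy⟩
    have hUab : Ioo a b ∈ U := mem_of_superset (hU (mem_principal_self _)) sdiff_subset
    obtain ⟨t, ht, hUt⟩ := isCompact_Icc.ultrafilter_le_nhds' U
      (mem_of_superset hUab Ioo_subset_Icc_self)
    rcases ht.1.eq_or_lt with rfl | hat
    · exact hy (Or.inl (mapClusterPt_iff_ultrafilter.mpr
        ⟨U, le_inf hUt (le_principal_iff.mpr (mem_of_superset hUab fun _ h => h.1)), hUy⟩))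
    rcases ht.2.eq_or_lt with rfl | htb
    · exact hy (Or.inr (mapClusterPt_iff_ultrafilter.mpr
        ⟨U, le_inf hUt (le_principal_iff.mpr (mem_of_superset hUab fun _ h => h.2)), hUy⟩))
    have hty : γ t = y := tendsto_nhds_unique
      ((hγ.continuousAt (isOpen_Ioo.mem_nhds ⟨hat, htb⟩)).tendsto.mono_left hUt) hUy
    have hUT : T ∈ U := hUt (hT.mem_nhds (hyT t ⟨hat, htb⟩ hty))
    exact U.empty_notMem (mem_of_superset (inter_mem (hU (mem_principal_self _)) hUT)
      fun _ h => h.1.2 h.2)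
  rw [mapClusterPt_iff_frequently] at hcluster
  push Not at hcluster
  obtain ⟨s, hs, hsT⟩ := hcluster
  filter_upwards [hs] with z hz t ht htz
  by_contra htT
  exact hsT ⟨ht, htT⟩ (htz ▸ hz)

theorem compl_image_mem_nhds (hγ : ContinuousOn γ (Ioo a b)) {y : Fin 2 → ℝ}
    (hy : y ∉ endLimits a b γ) (hyγ : y ∉ γ '' Ioo a b) : (γ '' Ioo a b)ᶜ ∈ 𝓝 y := by
  filter_upwards [eventually_forall_param_mem hγ hy isOpen_empty
    fun t ht hty => hyγ ⟨t, ht, hty⟩] with z hz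
  rintro ⟨t, ht, htz⟩
  exact hz t ht htz

theorem countable_transversal_selfIntersections {I : Set ℝ}
    (hγ : ∀ t ∈ I, DifferentiableAt ℝ γ t) :
    {z : ℝ × ℝ | z.1 ∈ I ∧ z.2 ∈ I ∧ cross (deriv γ z.1) (deriv γ z.2) ≠ 0 ∧
      γ z.1 = γ z.2}.Countable := by
  set S : Set (ℝ × ℝ) := {z | z.1 ∈ I ∧ z.2 ∈ I ∧ cross (deriv γ z.1) (deriv γ z.2) ≠ 0 ∧
    γ z.1 = γ z.2}
  have isolated : ∀ z ∈ S, ∀ᶠ w in 𝓝[≠] z, w ∉ S := by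
    rintro ⟨t, s⟩ ⟨ht, hs, hts, -⟩
    have hderiv : HasFDerivAt (fun z : ℝ × ℝ => γ z.1 - γ z.2) _ (t, s) :=
      ((hγ t ht).hasDerivAt.hasFDerivAt.comp (t, s) hasFDerivAt_fst).sub
        ((hγ s hs).hasDerivAt.hasFDerivAt.comp (t, s) hasFDerivAt_snd)
    refine (hderiv.eventually_ne (c := 0) ?_).mono fun z hz hzS => hz (sub_eq_zero.mpr hzS.2.2.2)
    refine (LinearMap.exists_antilipschitzWith (ContinuousLinearMap.toLinearMap _)
      (LinearMap.ker_eq_bot'.mpr ?_)).imp fun _ hK => hK.2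
    rintro ⟨x, y⟩ hxy
    have hxy' : x • deriv γ t = y • deriv γ s := by simpa [sub_eq_zero] using hxy
    have hx : x * cross (deriv γ t) (deriv γ s) = 0 := by
      rw [← cross_smul_left, hxy', cross_smul_left, cross_self, mul_zero]
    have hy : y * cross (deriv γ t) (deriv γ s) = 0 := by
      rw [← cross_smul_right, ← hxy', cross_smul_right, cross_self, mul_zero]
    rw [Prod.mk_eq_zero]
    exact ⟨(mul_eq_zero.mp hx).resolve_right hts, (mul_eq_zero.mp hy).resolve_right hts⟩
  have hdisc : DiscreteTopology S := discreteTopology_subtype_iff.mpr fun z hz => by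
    rw [← Filter.empty_mem_iff_bot, Filter.mem_inf_principal]
    exact (isolated z hz).mono fun w hw hwS => hw hwS
  exact countable_coe_iff.mp (TopologicalSpace.separableSpace_iff_countable.mp inferInstance)

end Curves

namespace IsChamber

variable {Γ C D : Set (Fin 2 → ℝ)} {x d : Fin 2 → ℝ}

theorem eq_connectedComponentIn (hC : IsChamber Γ C) (hx : x ∈ C) :
    C = connectedComponentIn Γᶜ x := by
  obtain ⟨p, -, rfl⟩ := hC
  exact connectedComponentIn_eq hx

theorem nonempty (hC : IsChamber Γ C) : C.Nonempty := by
  obtain ⟨p, hp, rfl⟩ := hC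
  exact ⟨p, mem_connectedComponentIn hp⟩

theorem subset_compl (hC : IsChamber Γ C) : C ⊆ Γᶜ := by
  obtain ⟨p, -, rfl⟩ := hC
  exact connectedComponentIn_subset _ _

theorem eq_of_mem (hC : IsChamber Γ C) (hD : IsChamber Γ D) (hxC : x ∈ C) (hxD : x ∈ D) :
    C = D :=
  (hC.eq_connectedComponentIn hxC).trans (hD.eq_connectedComponentIn hxD).symm

theorem subset_of_isPreconnected (hC : IsChamber Γ C) {S : Set (Fin 2 → ℝ)}
    (hS : IsPreconnected S) (hSΓ : S ⊆ Γᶜ) (hxS : x ∈ S) (hxC : x ∈ C) : S ⊆ C := by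
  rw [hC.eq_connectedComponentIn hxC]
  exact hS.subset_connectedComponentIn hxS hSΓ

theorem image_add_smul_subset (hC : IsChamber Γ C) {s : Set ℝ} (hs : s.OrdConnected)
    (hfree : ∀ r ∈ s, x + r • d ∉ Γ) {r : ℝ} (hr : r ∈ s) (hrC : x + r • d ∈ C) :
    (fun r : ℝ => x + r • d) '' s ⊆ C :=
  hC.subset_of_isPreconnected (hs.isPreconnected.image _ (by fun_prop))
    (image_subset_iff.mpr hfree) (mem_image_of_mem _ hr) hrC

theorem add_smul_mem (hC : IsChamber Γ C) {r s : ℝ} (hfree : ∀ q ∈ uIcc r s, x + q • d ∉ Γ)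
    (hr : x + r • d ∈ C) : x + s • d ∈ C :=
  hC.image_add_smul_subset ordConnected_uIcc hfree left_mem_uIcc hr ⟨s, right_mem_uIcc, rfl⟩

theorem mem_nhds (hC : IsChamber Γ C) (hxC : x ∈ C) (hx : Γᶜ ∈ 𝓝 x) : C ∈ 𝓝 x := by
  rw [hC.eq_connectedComponentIn hxC]
  exact connectedComponentIn_mem_nhds hx

theorem interior_nonempty {a b : ℝ} {γ : ℝ → Fin 2 → ℝ} (hγ : ContinuousOn γ (Ioo a b))
    (hends : (endLimits a b γ).Finite) (hd : d ≠ 0)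
    (hlevel : ∀ c, {t | t ∈ Ioo a b ∧ cross d (γ t) = c}.Finite)
    (hC : IsChamber (γ '' Ioo a b) C) : (interior C).Nonempty := by
  obtain ⟨x, hx⟩ := hC.nonempty
  have hbad : ((fun s : ℝ => x + s • d) ⁻¹' (γ '' Ioo a b ∪ endLimits a b γ)).Finite := by
    refine ((((hlevel (cross d x)).image γ).union hends).preimage
      (add_smul_injective hd x).injOn).subset ?_
    rintro s (⟨t, ht, hts⟩ | hs)
    · exact Or.inl ⟨t, ⟨ht, by rw [hts, cross_add_smul]⟩, hts⟩
    · exact Or.inr hs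
  obtain ⟨c, hc, hfree⟩ := mem_nhdsGT_iff_exists_Ioo_subset.mp
    (nhdsGT_le_nhdsNE (0 : ℝ) (nhdsNE_le_cofinite 0 hbad.compl_mem_cofinite))
  obtain ⟨s, hs⟩ : (Ioo 0 c).Nonempty := nonempty_Ioo.mpr hc
  have hsfree : ∀ r ∈ Ico 0 c, x + r • d ∉ γ '' Ioo a b := by
    intro r hr hrΓ
    rcases hr.1.eq_or_lt with rfl | hpos
    · exact hC.subset_compl hx (by simpa using hrΓ)
    · exact hfree ⟨hpos, hr.2⟩ (Or.inl hrΓ)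
  have hsC : x + s • d ∈ C := hC.image_add_smul_subset ordConnected_Ico hsfree
    (left_mem_Ico.mpr hc) (by simpa using hx) ⟨s, Ioo_subset_Ico_self hs, rfl⟩
  exact ⟨x + s • d, mem_interior_iff_mem_nhds.mpr <| hC.mem_nhds hsC <|
    compl_image_mem_nhds hγ (fun h => hfree hs (Or.inr h)) (fun h => hfree hs (Or.inl h))⟩

end IsChamber

theorem exists_mem_cross_notMem {d : Fin 2 → ℝ} (hd : d ≠ 0) {U : Set (Fin 2 → ℝ)}
    (hU : IsOpen U) (hne : U.Nonempty) {F : Set ℝ} (hF : F.Countable) :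
    ∃ y ∈ U, cross d y ∉ F := by
  obtain ⟨x, hx⟩ := hne
  have hbad : {u : ℝ | cross d (x + u • rot d) ∈ F}.Countable := by
    refine hF.preimage_of_injOn (f := fun u => cross d (x + u • rot d)) fun u _ w _ he => ?_
    simp only [cross_add_smul_rot] at he
    exact mul_right_cancel₀ (dotProduct_self_pos hd).ne' (add_left_cancel he)
  obtain ⟨u, hu, huF⟩ := (hbad.dense_compl ℝ).inter_open_nonempty
    ((fun u : ℝ => x + u • rot d) ⁻¹' U) (hU.preimage (by fun_prop)) ⟨0, by simpa using hx⟩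
  exact ⟨_, hu, huF⟩

section FlowBox

/-- A box around `y` with sides parallel to `d` and `rot d` in which every line of direction `d`
meets `Γ` at most once, and away from the two sides parallel to `rot d`. -/
structure IsFlowBox (Γ : Set (Fin 2 → ℝ)) (y d : Fin 2 → ℝ) (η η' : ℝ) : Prop where
  width_pos : 0 < η
  height_pos : 0 < η'
  subsingleton : ∀ u, |u| < η' → {s : ℝ | |s| ≤ η ∧ y + u • rot d + s • d ∈ Γ}.Subsingleton
  side_free : ∀ u, |u| < η' → ∀ s : ℝ, |s| = η → y + u • rot d + s • d ∉ Γ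

namespace IsFlowBox

variable {Γ C : Set (Fin 2 → ℝ)} {y d : Fin 2 → ℝ} {η η' : ℝ}

theorem side_center_mem (hbox : IsFlowBox Γ y d η η') (hC : IsChamber Γ C) {u s : ℝ}
    (hu : |u| < η') (hs : |s| = η) (hmem : y + u • rot d + s • d ∈ C) : y + s • d ∈ C := by
  have hcomm : ∀ w : ℝ, y + w • rot d + s • d = y + s • d + w • rot d := fun w => by abel
  have hfree : ∀ w ∈ uIcc u 0, y + s • d + w • rot d ∉ Γ := fun w hw => by
    rw [← hcomm]
    refine hbox.side_free w ?_ s hs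
    simpa using (abs_sub_right_of_mem_uIcc hw).trans_lt (by simpa using hu)
  simpa using hC.add_smul_mem hfree (hcomm u ▸ hmem)

-- Moving from the point in direction `d` or `-d`, one of the two sides is reached without meeting
-- `Γ`; along that side one gets to its center.
theorem add_smul_mem_or_sub_smul_mem (hbox : IsFlowBox Γ y d η η') (hd : d ≠ 0)
    (hC : IsChamber Γ C) (hy : y ∈ closure C) : y + η • d ∈ C ∨ y - η • d ∈ C := by
  obtain ⟨u, s, hu, hs, hzC⟩ : ∃ u s, |u| < η' ∧ |s| < η ∧ y + u • rot d + s • d ∈ C := by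
    have hopen : IsOpen {z : Fin 2 → ℝ | |cross d (z - y) / (d ⬝ᵥ d)| < η' ∧
        |d ⬝ᵥ (z - y) / (d ⬝ᵥ d)| < η} := by
      refine IsOpen.and (isOpen_lt ?_ continuous_const) (isOpen_lt ?_ continuous_const)
      · exact (((continuous_cross d).comp (by fun_prop)).div_const _).abs
      · simp only [dotProduct, Fin.sum_univ_two, Pi.sub_apply]; fun_prop
    obtain ⟨z, ⟨hz₁, hz₂⟩, hzC⟩ := mem_closure_iff.mp hy _ hopen
      (by simpa [cross] using And.intro hbox.height_pos hbox.width_pos)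
    refine ⟨_, _, hz₁, hz₂, ?_⟩
    rwa [add_right_comm, ← eq_add_smul_add_smul_rot hd y z]
  have hs' := abs_lt.mp hs
  have hη : |η| = η := abs_of_pos hbox.width_pos
  by_cases hfree : ∀ r ∈ uIcc s η, y + u • rot d + r • d ∉ Γ
  · exact Or.inl (hbox.side_center_mem hC hu hη (hC.add_smul_mem hfree hzC))
  push Not at hfree
  obtain ⟨r, hr, hrΓ⟩ := hfree
  rw [uIcc_of_le hs'.2.le] at hr
  have hfree' : ∀ q ∈ uIcc s (-η), y + u • rot d + q • d ∉ Γ := by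
    intro q hq hqΓ
    rw [uIcc_of_ge hs'.1.le] at hq
    have hqr : q = r := hbox.subsingleton u hu
      ⟨abs_le.mpr ⟨hq.1, hq.2.trans hs'.2.le⟩, hqΓ⟩ ⟨abs_le.mpr ⟨hs'.1.le.trans hr.1, hr.2⟩, hrΓ⟩
    have hqs : q = s := le_antisymm hq.2 (hqr ▸ hr.1)
    exact hC.subset_compl hzC (hqs ▸ hqΓ)
  right
  simpa [sub_eq_add_neg] using hbox.side_center_mem hC hu (s := -η) (by rwa [abs_neg])
    (hC.add_smul_mem hfree' hzC)

theorem exists_add_smul_mem_add_neg_smul_mem (hbox : IsFlowBox Γ y d η η') (hd : d ≠ 0)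
    {D : Set (Fin 2 → ℝ)} (hC : IsChamber Γ C) (hD : IsChamber Γ D) (hCD : C ≠ D)
    (hyC : y ∈ closure C) (hyD : y ∈ closure D) :
    ∃ r, |r| = η ∧ y + r • d ∈ C ∧ y + (-r) • d ∈ D := by
  simp only [neg_smul, ← sub_eq_add_neg]
  rcases hbox.add_smul_mem_or_sub_smul_mem hd hC hyC with hC' | hC' <;>
    rcases hbox.add_smul_mem_or_sub_smul_mem hd hD hyD with hD' | hD'
  · exact absurd (hC.eq_of_mem hD hC' hD') hCD
  · exact ⟨η, abs_of_pos hbox.width_pos, hC', hD'⟩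
  · refine ⟨-η, by rw [abs_neg, abs_of_pos hbox.width_pos], ?_, ?_⟩
    · rwa [neg_smul, ← sub_eq_add_neg]
    · rwa [neg_smul, sub_neg_eq_add]
  · exact absurd (hC.eq_of_mem hD hC' hD') hCD

end IsFlowBox

variable {a b : ℝ} {γ : ℝ → Fin 2 → ℝ} {d : Fin 2 → ℝ} {t₀ : ℝ}

theorem eventually_subsingleton_line_inter (hγ : ContinuousOn γ (Ioo a b)) (hd : d ≠ 0)
    (hends : γ t₀ ∉ endLimits a b γ) (hsimple : ∀ t ∈ Ioo a b, γ t = γ t₀ → t = t₀)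
    {T : Set ℝ} (hT : IsOpen T) (ht₀T : t₀ ∈ T) (hinj : InjOn (fun t => cross d (γ t)) T) :
    ∀ᶠ η in 𝓝[>] (0 : ℝ), ∀ u, |u| ≤ η →
      {s : ℝ | |s| ≤ η ∧ γ t₀ + u • rot d + s • d ∈ γ '' Ioo a b}.Subsingleton := by
  have hcont : Tendsto (fun z : ℝ × ℝ => γ t₀ + z.1 • rot d + z.2 • d) (𝓝 0) (𝓝 (γ t₀)) :=
    Continuous.tendsto' (by fun_prop) _ _ (by simp)
  obtain ⟨ρ, hρ, hb⟩ := Metric.nhds_basis_closedBall.eventually_iff.mp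
    (hcont.eventually (eventually_forall_param_mem hγ hends hT
      fun t ht hty => hsimple t ht hty ▸ ht₀T))
  filter_upwards [Ioo_mem_nhdsGT hρ] with η hη u hu
  have hparam : ∀ s : ℝ, |s| ≤ η → ∀ t ∈ Ioo a b, γ t = γ t₀ + u • rot d + s • d → t ∈ T :=
    fun s hs => hb (x := (u, s)) (mem_closedBall_zero_iff.mpr
      (max_le (hu.trans hη.2.le) (hs.trans hη.2.le)))
  rintro s ⟨hs, t, ht, hts⟩ s' ⟨hs', t', ht', hts'⟩
  have htt' : t = t' := hinj (hparam s hs t ht hts) (hparam s' hs' t' ht' hts')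
    (by simp only [hts, hts', cross_add_smul])
  exact add_smul_injective hd _ (hts.symm.trans (htt' ▸ hts'))

theorem exists_isFlowBox (hγ : ContinuousOn γ (Ioo a b)) (hd : d ≠ 0) (ht₀ : t₀ ∈ Ioo a b)
    (hends : γ t₀ ∉ endLimits a b γ) (hsimple : ∀ t ∈ Ioo a b, γ t = γ t₀ → t = t₀)
    {T : Set ℝ} (hT : IsOpen T) (ht₀T : t₀ ∈ T) (hinj : InjOn (fun t => cross d (γ t)) T) :
    ∃ η η', IsFlowBox (γ '' Ioo a b) (γ t₀) d η η' := by
  have hfar : ∀ᶠ η in 𝓝[>] (0 : ℝ), ∀ s : ℝ, |s| = η → γ t₀ + s • d ∉ endLimits a b γ := by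
    have hcont : Tendsto (fun s : ℝ => γ t₀ + s • d) (𝓝 0) (𝓝 (γ t₀)) :=
      Continuous.tendsto' (by fun_prop) _ _ (by simp)
    obtain ⟨ρ, hρ, hb⟩ := Metric.nhds_basis_ball.eventually_iff.mp
      (hcont.eventually (isClosed_endLimits.isOpen_compl.mem_nhds hends))
    filter_upwards [Ioo_mem_nhdsGT hρ] with η hη s hs
    exact hb (mem_ball_zero_iff.mpr (hs.trans_lt hη.2))
  obtain ⟨η, ⟨hsub, hη'⟩, hη⟩ := (((eventually_subsingleton_line_inter hγ hd hends hsimple hT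
    ht₀T hinj).and hfar).and self_mem_nhdsWithin).exists
  replace hη : 0 < η := hη
  have hside : ∀ s : ℝ, |s| = η →
      ∀ᶠ u in 𝓝 (0 : ℝ), γ t₀ + u • rot d + s • d ∉ γ '' Ioo a b := by
    intro s hs
    have h0 : γ t₀ + s • d ∉ γ '' Ioo a b := fun hmem => by
      have hs0 : s = 0 := hsub 0 (by simpa using hη.le) ⟨hs.le, by simpa using hmem⟩
        ⟨by simpa using hη.le, t₀, ht₀, by simp⟩
      rw [hs0, abs_zero] at hs
      exact hη.ne hs
    have hcont : Tendsto (fun u : ℝ => γ t₀ + u • rot d + s • d) (𝓝 0) (𝓝 (γ t₀ + s • d)) :=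
      Continuous.tendsto' (by fun_prop) _ _ (by simp)
    exact hcont (compl_image_mem_nhds hγ (hη' s hs) h0)
  obtain ⟨η', hη', hfree⟩ := Metric.eventually_nhds_iff.mp
    ((hside η (abs_of_pos hη)).and (hside (-η) (by rw [abs_neg, abs_of_pos hη])))
  refine ⟨η, min η' η, hη, lt_min hη' hη, fun u hu => hsub u (hu.le.trans (min_le_right _ _)),
    fun u hu s hs => ?_⟩
  have hu' := hfree (y := u) (by simpa using hu.trans_le (min_le_left _ _))
  rcases eq_or_eq_neg_of_abs_eq hs with rfl | rfl
  exacts [hu'.1, hu'.2]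

end FlowBox

section CurveDepth

/-- The intersections of a path with the curve `γ` on `I`: pairs of a time and a curve parameter
with the same image, so that every branch of the curve counts. -/
def pathCrossings (γ : ℝ → Fin 2 → ℝ) (I : Set ℝ) (α : ℝ → Fin 2 → ℝ) : Set (ℝ × ℝ) :=
  {q | q.1 ∈ Icc (0 : ℝ) 1 ∧ q.2 ∈ I ∧ α q.1 = γ q.2}

/-- The path `α : [0, 1] → ℝ²` meets the curve `γ` on `I` transversally. -/
def IsTransversal (γ : ℝ → Fin 2 → ℝ) (I : Set ℝ) (α : ℝ → Fin 2 → ℝ) : Prop :=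
  ContinuousOn α (Icc 0 1) ∧
    ∀ q ∈ pathCrossings γ I α, ∃ u, HasDerivAt α u q.1 ∧ cross u (deriv γ q.2) ≠ 0

/-- The depth of a chamber of the curve `γ` on `I`: the analogue of `depth` for a curve that is
parametrized by real numbers. -/
noncomputable def curveDepth (γ : ℝ → Fin 2 → ℝ) (I : Set ℝ) (C : Set (Fin 2 → ℝ)) : ℕ∞ :=
  ⨅ (α : ℝ → Fin 2 → ℝ) (_ : IsTransversal γ I α) (_ : α 0 ∈ C)
    (_ : ∃ D, IsOuter (γ '' I) D ∧ α 1 ∈ D), (pathCrossings γ I α).encard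

/-- The parameters in `I` at which `γ` meets the part `{x + s • d | s ∈ S}` of a line. -/
def lineParams (γ : ℝ → Fin 2 → ℝ) (I : Set ℝ) (x d : Fin 2 → ℝ) (S : Set ℝ) : Set ℝ :=
  {t | t ∈ I ∧ ∃ s ∈ S, γ t = x + s • d}

/-- The line through `x` of direction `d` meets the curve `γ` on `I` at most `k` times, always
transversally. -/
structure IsTransversalLine (γ : ℝ → Fin 2 → ℝ) (I : Set ℝ) (k : ℕ) (x d : Fin 2 → ℝ) :
    Prop where
  ne_zero : d ≠ 0
  cross_deriv_ne_zero : ∀ t ∈ I, cross d (γ t) = cross d x → cross d (deriv γ t) ≠ 0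
  encard_le : {t | t ∈ I ∧ cross d (γ t) = cross d x}.encard ≤ k

/-- The direction `d` is tangent to the curve `γ` on `I` only at its singular points, and lines of
direction `d` meet the curve at most `k` times. -/
structure IsGenericDirection (γ : ℝ → Fin 2 → ℝ) (I : Set ℝ) (k : ℕ) (d : Fin 2 → ℝ) :
    Prop where
  ne_zero : d ≠ 0
  cross_deriv_ne_zero : ∀ t ∈ I, deriv γ t ≠ 0 → cross d (deriv γ t) ≠ 0
  encard_level_le : ∀ c, {t | t ∈ I ∧ cross d (γ t) = c}.encard ≤ k

/-- Two different chambers of the curve `γ` on `I` whose common boundary contains the image of a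
nonempty open set of parameters: the analogue of `Adjacent`. -/
def CurveAdjacent (γ : ℝ → Fin 2 → ℝ) (I : Set ℝ) (C D : Set (Fin 2 → ℝ)) : Prop :=
  C ≠ D ∧ ∃ U ⊆ I, IsOpen U ∧ U.Nonempty ∧ γ '' U ⊆ frontier C ∩ frontier D

variable {γ : ℝ → Fin 2 → ℝ} {I : Set ℝ} {k : ℕ} {C D : Set (Fin 2 → ℝ)} {x d : Fin 2 → ℝ}

theorem curveDepth_le_encard_pathCrossings {α : ℝ → Fin 2 → ℝ} (hα : IsTransversal γ I α)
    (h0 : α 0 ∈ C) (hD : IsOuter (γ '' I) D) (h1 : α 1 ∈ D) :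
    curveDepth γ I C ≤ (pathCrossings γ I α).encard :=
  iInf_le_of_le α <| iInf_le_of_le hα <| iInf_le_of_le h0 <| iInf_le_of_le ⟨D, hD, h1⟩ le_rfl

theorem one_le_curveDepth (hC : IsChamber (γ '' I) C) (hout : ¬ IsOuter (γ '' I) C) :
    1 ≤ curveDepth γ I C := by
  refine le_iInf fun α => le_iInf fun hα => le_iInf fun h0 => le_iInf fun ⟨D, hD, h1⟩ => ?_
  rw [one_le_encard_iff_nonempty]
  by_contra hempty
  have hfree : α '' Icc 0 1 ⊆ (γ '' I)ᶜ := by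
    rintro _ ⟨u, hu, rfl⟩ ⟨t, ht, htu⟩
    exact hempty ⟨(u, t), hu, ht, htu.symm⟩
  have h1C : α 1 ∈ C := hC.subset_of_isPreconnected (isPreconnected_Icc.image α hα.1) hfree
    ⟨0, by simp, rfl⟩ h0 ⟨1, by simp, rfl⟩
  exact hout (hC.eq_of_mem hD.1 h1C h1 ▸ hD)

theorem tendsto_add_smul_cobounded {E : Type*} [NormedAddCommGroup E] [NormedSpace ℝ E] {d : E}
    (hd : d ≠ 0) (x : E) :
    Tendsto (fun s : ℝ => x + s • d) (Bornology.cobounded ℝ) (Bornology.cobounded E) := by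
  refine (tendsto_const_add_cobounded x).comp (tendsto_norm_atTop_iff_cobounded.mp ?_)
  simpa only [norm_smul] using
    tendsto_norm_cobounded_atTop.atTop_mul_const (norm_pos_iff.mpr hd)

theorem not_isBounded_of_ray (hd : d ≠ 0) {R : ℝ} (hD : ∀ s, R ≤ s → x + s • d ∈ D) :
    ¬ Bornology.IsBounded D := by
  intro hbdd
  have hray := (tendsto_add_smul_cobounded hd x).mono_left IsOrderBornology.atTop_le_cobounded
  obtain ⟨s, hs, hsD⟩ :=
    ((eventually_ge_atTop R).and (hray (Bornology.isBounded_def.mp hbdd))).exists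
  exact hsD (hD s hs)

theorem lineParams_mono {S T : Set ℝ} (h : S ⊆ T) :
    lineParams γ I x d S ⊆ lineParams γ I x d T :=
  fun _ ⟨ht, s, hs, hts⟩ => ⟨ht, s, h hs, hts⟩

theorem lineParams_subset_level (S : Set ℝ) :
    lineParams γ I x d S ⊆ {t | t ∈ I ∧ cross d (γ t) = cross d x} :=
  fun _ ⟨ht, s, _, hts⟩ => ⟨ht, by rw [hts, cross_add_smul]⟩

theorem disjoint_lineParams (hd : d ≠ 0) {S T : Set ℝ} (h : Disjoint S T) :
    Disjoint (lineParams γ I x d S) (lineParams γ I x d T) := by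
  rw [Set.disjoint_left] at h ⊢
  rintro t ⟨-, s, hs, hts⟩ ⟨-, s', hs', hts'⟩
  exact h hs (add_smul_injective hd x (hts.symm.trans hts') ▸ hs')

theorem lineParams_add_smul_smul (c r : ℝ) (S : Set ℝ) :
    lineParams γ I (x + c • d) (r • d) S = lineParams γ I x d ((fun s => c + s * r) '' S) := by
  ext t
  simp only [lineParams, mem_ofPred_eq, exists_mem_image, add_smul, mul_smul, add_assoc]

namespace IsTransversalLine

theorem rebase (h : IsTransversalLine γ I k x d) (c : ℝ) {r : ℝ} (hr : r ≠ 0) :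
    IsTransversalLine γ I k (x + c • d) (r • d) where
  ne_zero := smul_ne_zero hr h.ne_zero
  cross_deriv_ne_zero t ht := by
    simpa [cross_smul_left, cross_add_smul, hr] using h.cross_deriv_ne_zero t ht
  encard_le := by simpa [cross_smul_left, cross_add_smul, hr] using h.encard_le

theorem encard_pathCrossings_le (h : IsTransversalLine γ I k x d) :
    (pathCrossings γ I fun u => x + u • d).encard ≤ (lineParams γ I x d (Icc 0 1)).encard := by
  refine encard_le_encard_of_injOn (f := Prod.snd) (fun q hq => ⟨hq.2.1, q.1, hq.1, hq.2.2.symm⟩) ?_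
  rintro ⟨u, t⟩ ⟨-, -, hut⟩ ⟨u', t'⟩ ⟨-, -, hut'⟩ rfl
  exact Prod.ext (add_smul_injective h.ne_zero x (hut.trans hut'.symm)) rfl

theorem curveDepth_le_encard_unit (h : IsTransversalLine γ I k x d) (hx : x ∈ C)
    (hD : IsOuter (γ '' I) D) (hxD : x + d ∈ D) :
    curveDepth γ I C ≤ (lineParams γ I x d (Icc 0 1)).encard := by
  refine (curveDepth_le_encard_pathCrossings ⟨by fun_prop, ?_⟩ (by simpa using hx) hD
    (by simpa using hxD)).trans h.encard_pathCrossings_le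
  rintro ⟨u, t⟩ ⟨-, ht, hut⟩
  refine ⟨d, by simpa using ((hasDerivAt_id u).smul_const d).const_add x, ?_⟩
  exact h.cross_deriv_ne_zero t ht (by rw [← hut, cross_add_smul])

theorem finite_lineParams (h : IsTransversalLine γ I k x d) (S : Set ℝ) :
    (lineParams γ I x d S).Finite :=
  (finite_of_encard_le_coe h.encard_le).subset (lineParams_subset_level S)

theorem exists_isOuter_add_smul_mem (h : IsTransversalLine γ I k x d) :
    ∃ R : ℝ, 0 < R ∧ ∃ D, IsOuter (γ '' I) D ∧ x + R • d ∈ D := by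
  have hhits : {s : ℝ | x + s • d ∈ γ '' I}.Finite := by
    refine (((h.finite_lineParams univ).image γ).preimage
      (add_smul_injective h.ne_zero x).injOn).subset ?_
    rintro s ⟨t, ht, hts⟩
    exact ⟨t, ⟨ht, s, mem_univ s, hts⟩, hts⟩
  obtain ⟨R, hR⟩ := ((eventually_gt_atTop 0).and
    (atTop_le_cofinite hhits.compl_mem_cofinite)).exists_forall_of_atTop
  have hfree : ∀ s, R ≤ s → x + s • d ∉ γ '' I := fun s hs => (hR s hs).2
  have hmem := mem_connectedComponentIn (F := (γ '' I)ᶜ) (hfree R le_rfl)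
  have hchamber : IsChamber (γ '' I) (connectedComponentIn (γ '' I)ᶜ (x + R • d)) :=
    ⟨_, hfree R le_rfl, rfl⟩
  refine ⟨R, (hR R le_rfl).1, _, ⟨hchamber, ?_⟩, hmem⟩
  exact not_isBounded_of_ray h.ne_zero fun s hs =>
    hchamber.image_add_smul_subset ordConnected_Ici hfree self_mem_Ici hmem ⟨s, hs, rfl⟩

theorem curveDepth_le_encard_ray (h : IsTransversalLine γ I k x d) (hC : IsChamber (γ '' I) C)
    (hx : x ∈ C) : curveDepth γ I C ≤ (lineParams γ I x d (Ioi 0)).encard := by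
  obtain ⟨R, hR, D, hD, hRD⟩ := h.exists_isOuter_add_smul_mem
  have hR' : IsTransversalLine γ I k x (R • d) := by simpa using h.rebase 0 hR.ne'
  refine (hR'.curveDepth_le_encard_unit hx hD hRD).trans (encard_le_encard ?_)
  rintro t ⟨ht, s, hs, hts⟩
  refine ⟨ht, s * R, mul_pos (hs.1.lt_of_ne ?_) hR, by rw [hts, mul_smul]⟩
  rintro rfl
  exact hC.subset_compl hx ⟨t, ht, by simpa using hts⟩

theorem curveDepth_le_encard_Ioi (h : IsTransversalLine γ I k x d) (hC : IsChamber (γ '' I) C)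
    {r : ℝ} (hr : x + r • d ∈ C) : curveDepth γ I C ≤ (lineParams γ I x d (Ioi r)).encard := by
  have := (h.rebase r one_ne_zero).curveDepth_le_encard_ray hC hr
  rw [lineParams_add_smul_smul] at this
  simpa using this

theorem curveDepth_le_encard_Iio (h : IsTransversalLine γ I k x d) (hC : IsChamber (γ '' I) C)
    {r : ℝ} (hr : x + r • d ∈ C) : curveDepth γ I C ≤ (lineParams γ I x d (Iio r)).encard := by
  have := (h.rebase r (neg_ne_zero.mpr one_ne_zero)).curveDepth_le_encard_ray hC hr
  rw [lineParams_add_smul_smul] at this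
  simpa [← sub_eq_add_neg] using this

theorem curveDepth_le_encard_Icc (h : IsTransversalLine γ I k x d) {r s : ℝ} (hsr : s < r)
    (hr : x + r • d ∈ C) (hD : IsOuter (γ '' I) D) (hs : x + s • d ∈ D) :
    curveDepth γ I C ≤ (lineParams γ I x d (Icc s r)).encard := by
  have := (h.rebase r (sub_neg.mpr hsr).ne).curveDepth_le_encard_unit hr hD
    (by rwa [add_assoc, ← add_smul, add_sub_cancel])
  rw [lineParams_add_smul_smul] at this
  refine this.trans (encard_le_encard (lineParams_mono ?_))
  rintro _ ⟨u, hu, rfl⟩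
  constructor <;> nlinarith [hu.1, hu.2]

-- The two half-lines that point away from each other lead to outer chambers.
theorem curveDepth_add_curveDepth_add_encard_le (h : IsTransversalLine γ I k x d)
    (hC : IsChamber (γ '' I) C) (hD : IsChamber (γ '' I) D) {r s : ℝ} (hsr : s ≤ r)
    (hr : x + r • d ∈ C) (hs : x + s • d ∈ D) :
    curveDepth γ I C + curveDepth γ I D + (lineParams γ I x d (Icc s r)).encard ≤ k := by
  have hdisj : Disjoint (Ioi r) (Iio s) := Set.disjoint_left.mpr fun u hru hus =>
    (hsr.trans_lt hru).not_gt hus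
  have hdisj' : Disjoint (Ioi r ∪ Iio s) (Icc s r) := Set.disjoint_left.mpr fun u hu hsur =>
    hu.elim (fun hru => hsur.2.not_gt hru) fun hus => hsur.1.not_gt hus
  calc curveDepth γ I C + curveDepth γ I D + (lineParams γ I x d (Icc s r)).encard
    _ ≤ (lineParams γ I x d (Ioi r)).encard + (lineParams γ I x d (Iio s)).encard +
        (lineParams γ I x d (Icc s r)).encard := by
      gcongr
      exacts [h.curveDepth_le_encard_Ioi hC hr, h.curveDepth_le_encard_Iio hD hs]
    _ = (lineParams γ I x d (Ioi r) ∪ lineParams γ I x d (Iio s) ∪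
        lineParams γ I x d (Icc s r)).encard := by
      rw [encard_union_eq, encard_union_eq (disjoint_lineParams h.ne_zero hdisj)]
      exact (disjoint_lineParams h.ne_zero hdisj').mono_left
        (union_subset (lineParams_mono subset_union_left) (lineParams_mono subset_union_right))
    _ ≤ k := (encard_le_encard (union_subset (union_subset (lineParams_subset_level _)
        (lineParams_subset_level _)) (lineParams_subset_level _))).trans h.encard_le

end IsTransversalLine

namespace IsGenericDirection

theorem finite_level (h : IsGenericDirection γ I k d) (c : ℝ) :
    {t | t ∈ I ∧ cross d (γ t) = c}.Finite :=
  finite_of_encard_le_coe (h.encard_level_le c)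

theorem isTransversalLine (h : IsGenericDirection γ I k d)
    (hx : ∀ t ∈ I, cross d (γ t) = cross d x → deriv γ t ≠ 0) :
    IsTransversalLine γ I k x d :=
  ⟨h.ne_zero, fun t ht hts => h.cross_deriv_ne_zero t ht (hx t ht hts), h.encard_level_le _⟩

end IsGenericDirection

end CurveDepth

section Fronts

/-- `γ` is a front on `(a, b)` with normal vectors `p + t • v` that rotate monotonically, and `h`
is its velocity along the tangent vectors `rot (p + t • v)`. The zeros of `h` are its cusps. -/
structure IsFront (a b : ℝ) (γ : ℝ → Fin 2 → ℝ) (h : ℝ → ℝ) (p v : Fin 2 → ℝ) : Prop where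
  lt : a < b
  hasDerivAt : ∀ t ∈ Ioo a b, HasDerivAt γ (h t • rot (p + t • v)) t
  cross_eq_one : cross p v = 1

theorem subsingleton_mapClusterPt {ι : Type*} {l : Filter ι} {γ : ι → Fin 2 → ℝ}
    (hγ : ∀ d ≠ 0, ∃ L : EReal, Tendsto (fun t => (cross d (γ t) : EReal)) l (𝓝 L)) :
    {y | MapClusterPt y l γ}.Subsingleton := by
  intro y hy y' hy'
  by_contra hne
  have hw : cross (rot (y - y')) (y - y') ≠ 0 := by
    rw [← rot_dotProduct, ← neg_ne_zero]
    convert (dotProduct_self_pos (sub_ne_zero.mpr hne)).ne' using 1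
    simp only [rot, dotProduct, Fin.sum_univ_two, Matrix.cons_val_zero, Matrix.cons_val_one]
    ring
  obtain ⟨L, hL⟩ := hγ (rot (y - y')) fun h0 => hw (by rw [h0]; simp [cross])
  have heq : ∀ z, MapClusterPt z l γ → (cross (rot (y - y')) z : EReal) = L := by
    intro z hz
    have hcont : Continuous fun z => (cross (rot (y - y')) z : EReal) :=
      continuous_coe_real_ereal.comp (continuous_cross _)
    have : (𝓝 (cross (rot (y - y')) z : EReal) ⊓ 𝓝 L).NeBot :=
      (hz.continuousAt_comp hcont.continuousAt).neBot.mono (inf_le_inf_left _ hL)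
    exact eq_of_nhds_neBot this
  refine hw ?_
  rw [cross_sub_right, sub_eq_zero]
  exact_mod_cast (heq y hy).trans (heq y' hy').symm

namespace IsFront

variable {a b : ℝ} {γ : ℝ → Fin 2 → ℝ} {h : ℝ → ℝ} {p v : Fin 2 → ℝ}

theorem continuousOn (hF : IsFront a b γ h p v) : ContinuousOn γ (Ioo a b) :=
  fun t ht => (hF.hasDerivAt t ht).continuousAt.continuousWithinAt

theorem deriv_eq (hF : IsFront a b γ h p v) {t : ℝ} (ht : t ∈ Ioo a b) :
    deriv γ t = h t • rot (p + t • v) :=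
  (hF.hasDerivAt t ht).deriv

theorem cross_deriv (hF : IsFront a b γ h p v) (d : Fin 2 → ℝ) {t : ℝ} (ht : t ∈ Ioo a b) :
    cross d (deriv γ t) = h t * (d ⬝ᵥ (p + t • v)) := by
  rw [hF.deriv_eq ht, cross_smul_right, cross_rot]

theorem hasDerivAt_cross (hF : IsFront a b γ h p v) (d : Fin 2 → ℝ) {t : ℝ} (ht : t ∈ Ioo a b) :
    HasDerivAt (fun t => cross d (γ t)) (h t * (d ⬝ᵥ (p + t • v))) t := by
  rw [← hF.cross_deriv d ht]
  have hd := hasDerivAt_pi.mp (hF.hasDerivAt t ht).differentiableAt.hasDerivAt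
  exact ((hd 1).const_mul (d 0)).sub ((hd 0).const_mul (d 1))

theorem cross_normal (hF : IsFront a b γ h p v) (s t : ℝ) :
    cross (p + s • v) (p + t • v) = t - s := by
  have := hF.cross_eq_one
  simp only [cross, Pi.add_apply, Pi.smul_apply, smul_eq_mul] at this ⊢
  linear_combination (t - s) * this

theorem neg_rot_dotProduct_normal (hF : IsFront a b γ h p v) (t : ℝ) :
    -rot v ⬝ᵥ (p + t • v) = 1 := by
  rw [← hF.cross_eq_one]
  simp only [cross, rot, dotProduct, Fin.sum_univ_two, Pi.add_apply, Pi.smul_apply, Pi.neg_apply,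
    smul_eq_mul, Matrix.cons_val_zero, Matrix.cons_val_one]
  ring

theorem deriv_eq_zero_iff (hF : IsFront a b γ h p v) {t : ℝ} (ht : t ∈ Ioo a b) :
    deriv γ t = 0 ↔ h t = 0 := by
  refine ⟨fun h0 => ?_, fun h0 => by rw [hF.deriv_eq ht, h0, zero_smul]⟩
  have := hF.cross_deriv (-rot v) ht
  rw [hF.neg_rot_dotProduct_normal, mul_one, h0] at this
  simpa [cross] using this.symm

theorem subsingleton_dotProduct_normal (hF : IsFront a b γ h p v) {d : Fin 2 → ℝ} (hd : d ≠ 0) :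
    {t : ℝ | d ⬝ᵥ (p + t • v) = 0}.Subsingleton := by
  intro s hs t ht
  have hz := congrArg (d ⬝ᵥ ·) (cross_smul_eq (p + s • v) (p + t • v) d)
  simp only [dotProduct_add, dotProduct_smul, smul_eq_mul, hF.cross_normal] at hz
  simp only [mem_ofPred_eq, dotProduct_add, dotProduct_smul, smul_eq_mul] at hs ht
  rw [hs, ht, mul_zero, mul_zero, add_zero] at hz
  exact (sub_eq_zero.mp ((mul_eq_zero.mp hz).resolve_right (dotProduct_self_pos hd).ne')).symm

theorem finite_endLimits (hF : IsFront a b γ h p v) (hZ : {t | t ∈ Ioo a b ∧ h t = 0}.Finite) :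
    (endLimits a b γ).Finite := by
  have hne : ∀ d ≠ 0, ∀ l ≤ cofinite, (∀ᶠ t in l, t ∈ Ioo a b) →
      ∀ᶠ t in l, h t * (d ⬝ᵥ (p + t • v)) ≠ 0 := by
    intro d hd l hl hab
    filter_upwards [hab, hl hZ.compl_mem_cofinite,
      hl (hF.subsingleton_dotProduct_normal hd).finite.compl_mem_cofinite] with t ht ht' ht''
    exact mul_ne_zero (fun h0 => ht' ⟨ht, h0⟩) ht''
  have hl : ∀ᶠ t in 𝓝[>] a, t ∈ Ioo a b := Ioo_mem_nhdsGT hF.lt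
  have hr : ∀ᶠ t in 𝓝[<] b, t ∈ Ioo a b := Ioo_mem_nhdsLT hF.lt
  refine Finite.union (subsingleton_mapClusterPt fun d hd => ?_).finite
    (subsingleton_mapClusterPt fun d hd => ?_).finite
  · exact exists_tendsto_nhdsGT_of_hasDerivAt_ne_zero (hl.mono fun t => hF.hasDerivAt_cross d)
      (hne d hd _ (nhdsGT_le_nhdsNE a |>.trans (nhdsNE_le_cofinite a)) hl)
  · exact exists_tendsto_nhdsLT_of_hasDerivAt_ne_zero (hr.mono fun t => hF.hasDerivAt_cross d)
      (hne d hd _ (nhdsLT_le_nhdsNE b |>.trans (nhdsNE_le_cofinite b)) hr)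

theorem countable_selfIntersections (hF : IsFront a b γ h p v) :
    {t | ∃ s ∈ Ioo a b, t ∈ Ioo a b ∧ h t ≠ 0 ∧ h s ≠ 0 ∧ s ≠ t ∧ γ s = γ t}.Countable := by
  refine ((countable_transversal_selfIntersections
    fun t ht => (hF.hasDerivAt t ht).differentiableAt).image Prod.snd).mono ?_
  rintro t ⟨s, hs, ht, ht0, hs0, hst, he⟩
  refine ⟨(s, t), ⟨hs, ht, ?_, he⟩, rfl⟩
  rw [hF.cross_deriv _ ht, hF.deriv_eq hs, smul_dotProduct, rot_dotProduct, hF.cross_normal]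
  exact mul_ne_zero ht0 (mul_ne_zero hs0 (sub_ne_zero.mpr hst.symm))

theorem isGenericDirection (hF : IsFront a b γ h p v) {d : Fin 2 → ℝ} (hd : d ≠ 0) (Z : Finset ℝ)
    (hdn : ∀ t ∈ Ioo a b, h t ≠ 0 → d ⬝ᵥ (p + t • v) ≠ 0)
    (hZ : ∀ x ∈ Ioo a b, ∀ y ∈ Ioo a b, x < y → cross d (γ x) = cross d (γ y) →
      ∃ z ∈ Z, x < z ∧ z < y) :
    IsGenericDirection γ (Ioo a b) (Z.card + 1) d where
  ne_zero := hd
  cross_deriv_ne_zero t ht h0 := by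
    rw [Ne, hF.deriv_eq_zero_iff ht] at h0
    exact hF.cross_deriv d ht ▸ mul_ne_zero h0 (hdn t ht h0)
  encard_level_le c := by
    exact_mod_cast encard_level_le_card_add_one Z hZ c

theorem neg_rot_ne_zero (hF : IsFront a b γ h p v) : -rot v ≠ 0 := fun h0 => by
  simpa [h0] using hF.neg_rot_dotProduct_normal 0

theorem isGenericDirection_neg_rot (hF : IsFront a b γ h p v) (hh : ∀ t ∈ Ioo a b, h t ≠ 0) :
    IsGenericDirection γ (Ioo a b) 1 (-rot v) := by
  have hdn : ∀ t : ℝ, -rot v ⬝ᵥ (p + t • v) ≠ 0 := fun t => by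
    rw [hF.neg_rot_dotProduct_normal]; exact one_ne_zero
  refine hF.isGenericDirection hF.neg_rot_ne_zero ∅ (fun t _ _ => hdn t) ?_
  intro x hx y hy hxy he
  have hinj := injOn_of_hasDerivAt_ne_zero ordConnected_Ioo
    (fun t => hF.hasDerivAt_cross (-rot v)) fun t ht => mul_ne_zero (hh t ht) (hdn t)
  exact absurd (hinj hx hy he) hxy.ne

-- One cusp is saved by choosing `d` so that the derivative of `cross d ∘ γ` keeps its sign there:
-- any transverse `d` works if `h` keeps its sign, the tangent at the cusp works if `h` changes it.
theorem exists_direction_of_cusp (hF : IsFront a b γ h p v)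
    (hZ : {t | t ∈ Ioo a b ∧ h t = 0}.Finite) {τ : ℝ} (hτ : τ ∈ Ioo a b) :
    ∃ d ≠ 0, (∀ t, t ≠ τ → d ⬝ᵥ (p + t • v) ≠ 0) ∧ ∀ᶠ u in 𝓝[<] τ, ∀ᶠ w in 𝓝[>] τ,
      0 < h u * (d ⬝ᵥ (p + u • v)) * (h w * (d ⬝ᵥ (p + w • v))) := by
  have hab : ∀ᶠ t in 𝓝[≠] τ, t ∈ Ioo a b := nhdsWithin_le_nhds (isOpen_Ioo.mem_nhds hτ)
  have hsign := eventually_mul_pos_or_eventually_mul_neg (f := fun t => cross (-rot v) (γ t))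
    (f' := h) (τ := τ)
    (hab.mono fun t ht => by
      simpa only [hF.neg_rot_dotProduct_normal, mul_one] using hF.hasDerivAt_cross (-rot v) ht)
    (by filter_upwards [hab, nhdsNE_le_cofinite τ hZ.compl_mem_cofinite] with t ht ht' h0
        exact ht' ⟨ht, h0⟩)
  rcases hsign with hpos | hneg
  · refine ⟨-rot v, hF.neg_rot_ne_zero, fun t _ => ?_, ?_⟩ <;>
      simp only [hF.neg_rot_dotProduct_normal, mul_one]
    exacts [one_ne_zero, hpos]
  · have hd : ∀ t : ℝ, rot (p + τ • v) ⬝ᵥ (p + t • v) = t - τ := fun t => by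
      rw [rot_dotProduct, hF.cross_normal]
    refine ⟨rot (p + τ • v), fun h0 => ?_, fun t ht => ?_, ?_⟩
    · simpa [h0] using hd (τ + 1)
    · rw [hd]; exact sub_ne_zero.mpr ht
    · filter_upwards [hneg, self_mem_nhdsWithin] with u hu huτ
      filter_upwards [hu, self_mem_nhdsWithin] with w hw hwτ
      rw [hd, hd]
      nlinarith [mul_pos (neg_pos.mpr hw) (mul_pos (sub_pos.mpr huτ) (sub_pos.mpr hwτ))]

theorem exists_isGenericDirection (hF : IsFront a b γ h p v) {m : ℕ}
    (hm : {t | t ∈ Ioo a b ∧ h t = 0}.encard = m) :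
    ∃ d, IsGenericDirection γ (Ioo a b) (max m 1) d := by
  have hfin : {t | t ∈ Ioo a b ∧ h t = 0}.Finite := finite_of_encard_eq_coe hm
  have hcard : hfin.toFinset.card = m := by
    rw [hfin.encard_eq_coe_toFinset_card] at hm
    exact_mod_cast hm
  rcases Finset.eq_empty_or_nonempty hfin.toFinset with hempty | ⟨τ, hτ⟩
  · refine ⟨-rot v, ?_⟩
    rw [← hcard, hempty]
    exact hF.isGenericDirection_neg_rot fun t ht h0 =>
      Finset.notMem_empty t (hempty ▸ hfin.mem_toFinset.mpr ⟨ht, h0⟩)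
  · obtain ⟨hτab, hτ0⟩ := hfin.mem_toFinset.mp hτ
    obtain ⟨d, hd0, hdn, hsign⟩ := hF.exists_direction_of_cusp hfin hτab
    refine ⟨d, ?_⟩
    rw [← hcard, max_eq_left (Finset.card_pos.mpr ⟨τ, hτ⟩), ← Finset.card_erase_add_one hτ]
    refine hF.isGenericDirection hd0 _ (fun t _ h0 => hdn t fun htτ => h0 (htτ ▸ hτ0)) ?_
    intro x hx y hy hxy he
    have hIcc : Icc x y ⊆ Ioo a b := fun t ht => ⟨hx.1.trans_le ht.1, ht.2.trans_lt hy.2⟩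
    obtain ⟨z, hz, hzτ, hz0⟩ := exists_hasDerivAt_eq_zero_ne hxy
      (fun t ht => hF.hasDerivAt_cross d (hIcc ht)) hsign he
    exact ⟨z, Finset.mem_erase.mpr ⟨hzτ, hfin.mem_toFinset.mpr ⟨hIcc (Ioo_subset_Icc_self hz),
      (mul_eq_zero.mp hz0).resolve_right (hdn z hzτ)⟩⟩, hz⟩

theorem curveDepth_le_half (hF : IsFront a b γ h p v) {m : ℕ}
    (hm : {t | t ∈ Ioo a b ∧ h t = 0}.encard = m) {C : Set (Fin 2 → ℝ)}
    (hC : IsChamber (γ '' Ioo a b) C) : curveDepth γ (Ioo a b) C ≤ ((m / 2 : ℕ) : ℕ∞) := by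
  have hZ : {t | t ∈ Ioo a b ∧ h t = 0}.Finite := finite_of_encard_eq_coe hm
  obtain ⟨d, hd⟩ := hF.exists_isGenericDirection hm
  obtain ⟨y, hyC, hy⟩ := exists_mem_cross_notMem hd.ne_zero isOpen_interior
    (hC.interior_nonempty hF.continuousOn (hF.finite_endLimits hZ) hd.ne_zero hd.finite_level)
    (hZ.image fun t => cross d (γ t)).countable
  have hline : IsTransversalLine γ (Ioo a b) (max m 1) y d :=
    hd.isTransversalLine fun t ht hty h0 => hy ⟨t, ⟨ht, (hF.deriv_eq_zero_iff ht).mp h0⟩, hty⟩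
  have hy0 : y + (0 : ℝ) • d ∈ C := by simpa using interior_subset hyC
  have hsum := le_self_add.trans
    (hline.curveDepth_add_curveDepth_add_encard_le hC hC le_rfl hy0 hy0)
  lift curveDepth γ (Ioo a b) C to ℕ using
    ne_top_of_le_ne_top (ENat.natCast_ne_top _) (le_self_add.trans hsum) with D
  norm_cast at hsum ⊢
  omega

theorem exists_generic_param (hF : IsFront a b γ h p v)
    (hZ : {t | t ∈ Ioo a b ∧ h t = 0}.Finite) {k : ℕ} {d : Fin 2 → ℝ}
    (hd : IsGenericDirection γ (Ioo a b) k d) {U : Set ℝ} (hU : IsOpen U) (hne : U.Nonempty)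
    (hUab : U ⊆ Ioo a b) :
    ∃ t₀ ∈ U, IsTransversalLine γ (Ioo a b) k (γ t₀) d ∧ γ t₀ ∉ endLimits a b γ ∧
      ∀ t ∈ Ioo a b, γ t = γ t₀ → t = t₀ := by
  set F : Set ℝ := cross d '' (γ '' {t | t ∈ Ioo a b ∧ h t = 0} ∪ endLimits a b γ)
  have hF' : {t | t ∈ Ioo a b ∧ cross d (γ t) ∈ F}.Finite := by
    refine ((((hZ.image γ).union (hF.finite_endLimits hZ)).image (cross d)).biUnion
      fun c _ => hd.finite_level c).subset fun t ht => ?_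
    exact mem_biUnion ht.2 ⟨ht.1, rfl⟩
  obtain ⟨t₀, ht₀U, ht₀⟩ := ((hF'.countable.union hF.countable_selfIntersections).dense_compl
    ℝ).inter_open_nonempty U hU hne
  obtain ⟨hlevel, hself⟩ := not_or.mp ht₀
  have hcusp : ∀ t ∈ Ioo a b, cross d (γ t) = cross d (γ t₀) → h t ≠ 0 := fun t ht he h0 =>
    hlevel ⟨hUab ht₀U, γ t, Or.inl ⟨t, ⟨ht, h0⟩, rfl⟩, he⟩
  refine ⟨t₀, ht₀U, hd.isTransversalLine fun t ht he => ?_, fun hmem => ?_, fun t ht he => ?_⟩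
  · exact (hF.deriv_eq_zero_iff ht).not.mpr (hcusp t ht he)
  · exact hlevel ⟨hUab ht₀U, γ t₀, Or.inr hmem, rfl⟩
  · by_contra hne
    exact hself ⟨t, ht, hUab ht₀U, hcusp t₀ (hUab ht₀U) rfl, hcusp t ht (by rw [he]), hne, he⟩

theorem exists_isFlowBox (hF : IsFront a b γ h p v)
    (hZ : {t | t ∈ Ioo a b ∧ h t = 0}.Finite) {k : ℕ} {d : Fin 2 → ℝ}
    (hd : IsGenericDirection γ (Ioo a b) k d) {t₀ : ℝ} (ht₀ : t₀ ∈ Ioo a b) (hh : h t₀ ≠ 0)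
    (hends : γ t₀ ∉ endLimits a b γ) (hsimple : ∀ t ∈ Ioo a b, γ t = γ t₀ → t = t₀) :
    ∃ η η', IsFlowBox (γ '' Ioo a b) (γ t₀) d η η' := by
  obtain ⟨r, hr, hball⟩ := Metric.nhds_basis_ball.mem_iff.mp
    ((isOpen_Ioo.sdiff hZ.isClosed).mem_nhds ⟨ht₀, fun h0 => hh h0.2⟩)
  refine NearCircuit.exists_isFlowBox hF.continuousOn hd.ne_zero ht₀ hends hsimple
    Metric.isOpen_ball (Metric.mem_ball_self hr) ?_
  rw [Real.ball_eq_Ioo] at hball ⊢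
  refine injOn_of_hasDerivAt_ne_zero ordConnected_Ioo
    (fun t ht => hF.hasDerivAt_cross d (hball ht).1) fun t ht => ?_
  have ht' := (hball ht).1
  rw [← hF.cross_deriv d ht']
  exact hd.cross_deriv_ne_zero t ht' ((hF.deriv_eq_zero_iff ht').not.mpr fun h0 =>
    (hball ht).2 ⟨ht', h0⟩)

theorem exists_simple_crossing (hF : IsFront a b γ h p v)
    (hZ : {t | t ∈ Ioo a b ∧ h t = 0}.Finite) {k : ℕ} {d : Fin 2 → ℝ}
    (hd : IsGenericDirection γ (Ioo a b) k d) {C D : Set (Fin 2 → ℝ)}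
    (hC : IsChamber (γ '' Ioo a b) C) (hD : IsChamber (γ '' Ioo a b) D)
    (hadj : CurveAdjacent γ (Ioo a b) C D) :
    ∃ x d', IsTransversalLine γ (Ioo a b) k x d' ∧ x + (1 : ℝ) • d' ∈ C ∧
      x + (-1 : ℝ) • d' ∈ D ∧ (lineParams γ (Ioo a b) x d' (Icc (-1) 1)).encard = 1 := by
  obtain ⟨hCD, U, hUab, hU, hne, hUCD⟩ := hadj
  obtain ⟨t₀, ht₀U, hline, hends, hsimple⟩ := hF.exists_generic_param hZ hd hU hne hUab
  have ht₀ := hUab ht₀U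
  have hh : h t₀ ≠ 0 := fun h0 => hline.cross_deriv_ne_zero t₀ ht₀ rfl <| by
    rw [hF.cross_deriv d ht₀, h0, zero_mul]
  obtain ⟨η, η', hbox⟩ := hF.exists_isFlowBox hZ hd ht₀ hh hends hsimple
  obtain ⟨hyC, hyD⟩ := hUCD (mem_image_of_mem γ ht₀U)
  obtain ⟨r, hr, hrC, hrD⟩ := hbox.exists_add_smul_mem_add_neg_smul_mem hd.ne_zero hC hD hCD
    (frontier_subset_closure hyC) (frontier_subset_closure hyD)
  have hr0 : r ≠ 0 := abs_pos.mp (hr ▸ hbox.width_pos)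
  refine ⟨γ t₀, r • d, by simpa using hline.rebase 0 hr0, by simpa using hrC,
    by simpa using hrD, ?_⟩
  refine encard_eq_one.mpr ⟨t₀, Subset.antisymm ?_ (singleton_subset_iff.mpr
    ⟨ht₀, 0, by simp, by simp⟩)⟩
  rintro t ⟨ht, s, hs, hts⟩
  have hsr : s * r = 0 := hbox.subsingleton 0 (by simpa using hbox.height_pos)
    ⟨by simpa [abs_mul, hr] using mul_le_of_le_one_left hbox.width_pos.le (abs_le.mpr hs),
      t, ht, by simpa [smul_smul] using hts⟩
    ⟨by simpa using hbox.width_pos.le, t₀, ht₀, by simp⟩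
  exact hsimple t ht (by rw [hts, smul_smul, hsr, zero_smul, add_zero])

theorem curveDepth_add_curveDepth_add_one_le (hF : IsFront a b γ h p v) {m : ℕ}
    (hm : {t | t ∈ Ioo a b ∧ h t = 0}.encard = m) {C D : Set (Fin 2 → ℝ)}
    (hC : IsChamber (γ '' Ioo a b) C) (hD : IsChamber (γ '' Ioo a b) D)
    (hadj : CurveAdjacent γ (Ioo a b) C D) :
    curveDepth γ (Ioo a b) C + curveDepth γ (Ioo a b) D + 1 ≤ max m 1 := by
  obtain ⟨d, hd⟩ := hF.exists_isGenericDirection hm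
  obtain ⟨x, d', hline, hxC, hxD, hone⟩ := hF.exists_simple_crossing
    (finite_of_encard_eq_coe hm) hd hC hD hadj
  have := hline.curveDepth_add_curveDepth_add_encard_le hC hD (by norm_num) hxC hxD
  rw [hone] at this
  exact_mod_cast this

theorem curveDepth_le_one_of_curveAdjacent (hF : IsFront a b γ h p v)
    (hZ : {t | t ∈ Ioo a b ∧ h t = 0}.Finite) {C D : Set (Fin 2 → ℝ)}
    (hC : IsChamber (γ '' Ioo a b) C) (hD : IsOuter (γ '' Ioo a b) D)
    (hadj : CurveAdjacent γ (Ioo a b) C D) : curveDepth γ (Ioo a b) C ≤ 1 := by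
  obtain ⟨d, hd⟩ := hF.exists_isGenericDirection hZ.encard_eq_coe
  obtain ⟨x, d', hline, hxC, hxD, hone⟩ := hF.exists_simple_crossing hZ hd hC hD.1 hadj
  exact hone ▸ hline.curveDepth_le_encard_Icc (by norm_num) hxC hD hxD

end IsFront

end Fronts

section HornKapranov

variable {N : ℕ} {B : Matrix (Fin N) (Fin 2) ℝ} {ε : Fin N → SignType}

theorem ne_zero_of_mem_orthant (hε : ∀ i, ε i ≠ 0) {c : Fin N → ℝ} (hc : c ∈ orthant ε)
    (i : Fin N) : c i ≠ 0 := by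
  rw [← sign_ne_zero, hc i]
  exact hε i

theorem mem_orthant_iff (hε : ∀ i, ε i ≠ 0) {c : Fin N → ℝ} :
    c ∈ orthant ε ↔ ∀ i, 0 < (ε i : ℝ) * c i := by
  refine forall_congr' fun i => ?_
  rcases h : ε i with _ | _ | _
  · exact absurd h (hε i)
  · simp [sign_eq_neg_one_iff]
  · simp [sign_eq_one_iff]

theorem smul_mem_cone {l : Fin 2 → ℝ} (hl : l ∈ cone B ε) {r : ℝ} (hr : 0 < r) :
    r • l ∈ cone B ε := fun i => by
  rw [Matrix.mulVec_smul, Pi.smul_apply, smul_eq_mul, sign_mul, sign_pos hr, one_mul, hl i]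

theorem cone_eq_iInter (hε : ∀ i, ε i ≠ 0) :
    cone B ε = ⋂ i, {l | 0 < ((ε i : ℝ) • B i) ⬝ᵥ l} := by
  ext l
  simp only [cone, mem_ofPred_eq, mem_orthant_iff hε, mem_iInter, smul_dotProduct, smul_eq_mul]
  rfl

theorem isOpen_cone (hε : ∀ i, ε i ≠ 0) : IsOpen (cone B ε) := by
  rw [cone_eq_iInter hε]
  exact isOpen_iInter_of_finite fun i =>
    isOpen_lt continuous_const (continuous_const.dotProduct continuous_id)

theorem convex_cone (hε : ∀ i, ε i ≠ 0) : Convex ℝ (cone B ε) := by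
  rw [cone_eq_iInter hε]
  exact convex_iInter fun i => convex_halfSpace_gt (dotProductBilin ℝ ℝ _).isLinear 0

theorem mem_params_iff {l : Fin 2 → ℝ} :
    l ∈ params B ε ↔ l ∈ cone B ε ∧ ((fun i => (ε i : ℝ)) ᵥ* B) ⬝ᵥ l = 1 := by
  refine and_congr_right fun hl => ?_
  have habs : ∀ i, |(B *ᵥ l) i| = (ε i : ℝ) * (B *ᵥ l) i := fun i => by
    rw [← hl i, sign_mul_self]
  rw [← Matrix.dotProduct_mulVec, dotProduct, Finset.sum_congr rfl fun i _ => habs i]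

theorem exists_smul_mem_params [NeZero N] (hε : ∀ i, ε i ≠ 0) {l : Fin 2 → ℝ}
    (hl : l ∈ cone B ε) : ∃ r > (0 : ℝ), r • l ∈ params B ε := by
  have hpos : 0 < ∑ i, |(B *ᵥ l) i| :=
    Finset.sum_pos (fun i _ => abs_pos.mpr (ne_zero_of_mem_orthant hε hl i))
      Finset.univ_nonempty
  refine ⟨(∑ i, |(B *ᵥ l) i|)⁻¹, inv_pos.mpr hpos, smul_mem_cone hl (inv_pos.mpr hpos), ?_⟩
  simp only [Matrix.mulVec_smul, Pi.smul_apply, smul_eq_mul, abs_mul, ← Finset.mul_sum]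
  rw [abs_of_pos (inv_pos.mpr hpos), inv_mul_cancel₀ hpos.ne']

theorem logMap_mul {c u : Fin N → ℝ} (hc : ∀ i, c i ≠ 0) (hu : ∀ i, u i ≠ 0) :
    logMap B (c * u) = logMap B c + logMap B u := by
  rw [logMap, logMap, logMap, ← Matrix.mulVec_add]
  congr 1
  ext i
  rw [Pi.mul_apply, abs_mul, Real.log_mul (abs_ne_zero.mpr (hc i)) (abs_ne_zero.mpr (hu i))]
  rfl

theorem logMap_smul (hB : Bᵀ *ᵥ 1 = 0) {c : Fin N → ℝ} (hc : ∀ i, c i ≠ 0) {r : ℝ}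
    (hr : r ≠ 0) : logMap B (r • c) = logMap B c := by
  have hconst : logMap B (fun _ => r) = 0 := by
    rw [logMap, show (fun _ : Fin N => Real.log |r|) = Real.log |r| • 1 by ext; simp,
      Matrix.mulVec_smul, hB, smul_zero]
  rw [show r • c = c * fun _ => r by ext; simp [mul_comm], logMap_mul hc fun _ => hr, hconst,
    add_zero]

theorem xi_smul (hB : Bᵀ *ᵥ 1 = 0) (hε : ∀ i, ε i ≠ 0) {l : Fin 2 → ℝ} (hl : l ∈ cone B ε)
    {r : ℝ} (hr : 0 < r) : xi B (r • l) = xi B l := by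
  rw [xi, Matrix.mulVec_smul, logMap_smul hB (ne_zero_of_mem_orthant hε hl) hr.ne', xi]

/-- The Jacobian matrix of the Horn–Kapranov map. -/
noncomputable def xiJacobian (B : Matrix (Fin N) (Fin 2) ℝ) (l : Fin 2 → ℝ) :
    Matrix (Fin 2) (Fin 2) ℝ :=
  Bᵀ * (Matrix.diagonal (B *ᵥ l)⁻¹ * B)

theorem hasFDerivAt_xi {l : Fin 2 → ℝ} (hl : ∀ i, (B *ᵥ l) i ≠ 0) :
    HasFDerivAt (xi B) (LinearMap.toContinuousLinearMap (xiJacobian B l).mulVecLin) l := by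
  have hlog : HasFDerivAt (fun (c : Fin N → ℝ) i => Real.log |c i|)
      (LinearMap.toContinuousLinearMap (Matrix.diagonal (B *ᵥ l)⁻¹).mulVecLin) (B *ᵥ l) := by
    rw [hasFDerivAt_pi']
    intro i
    simp only [Real.log_abs]
    refine ((hasFDerivAt_apply i (B *ᵥ l)).log (hl i)).congr_fderiv ?_
    ext w
    simp [Matrix.mulVec_diagonal]
  have hcomp := (LinearMap.toContinuousLinearMap Bᵀ.mulVecLin).hasFDerivAt.comp l
    (hlog.comp l (LinearMap.toContinuousLinearMap B.mulVecLin).hasFDerivAt)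
  refine hcomp.congr_fderiv (ContinuousLinearMap.ext fun w => ?_)
  simp [xiJacobian]

theorem xiJacobian_mulVec_self (hB : Bᵀ *ᵥ 1 = 0) {l : Fin 2 → ℝ}
    (hl : ∀ i, (B *ᵥ l) i ≠ 0) : xiJacobian B l *ᵥ l = 0 := by
  have hone : Matrix.diagonal (B *ᵥ l)⁻¹ *ᵥ (B *ᵥ l) = 1 := by
    ext i
    rw [Matrix.mulVec_diagonal, Pi.inv_apply, inv_mul_cancel₀ (hl i), Pi.one_apply]
  rw [xiJacobian, ← Matrix.mulVec_mulVec, ← Matrix.mulVec_mulVec, hone, hB]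

theorem transpose_xiJacobian (l : Fin 2 → ℝ) : (xiJacobian B l)ᵀ = xiJacobian B l := by
  simp [xiJacobian, Matrix.mul_assoc]

-- The Jacobian matrix is symmetric and kills `l`, so its image is orthogonal to `l`.
theorem xiJacobian_mulVec (hB : Bᵀ *ᵥ 1 = 0) {l v : Fin 2 → ℝ} (hl : ∀ i, (B *ᵥ l) i ≠ 0)
    (hv : cross l v = 1) : xiJacobian B l *ᵥ v = (v ⬝ᵥ xiJacobian B l *ᵥ v) • rot l := by
  refine eq_dotProduct_smul_rot ?_ hv
  rw [Matrix.dotProduct_mulVec, ← Matrix.mulVec_transpose, transpose_xiJacobian,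
    xiJacobian_mulVec_self hB hl, zero_dotProduct]

/-- The parameters of the curve form the open segment of the points `p + t • v`, `t ∈ (a, b)`. -/
structure IsParamSegment (B : Matrix (Fin N) (Fin 2) ℝ) (ε : Fin N → SignType) (a b : ℝ)
    (p v : Fin 2 → ℝ) : Prop where
  lt : a < b
  cross_eq_one : cross p v = 1
  params_eq : params B ε = (fun t : ℝ => p + t • v) '' Ioo a b

theorem isBounded_setOf_add_smul_mem_params (hB : Function.Injective B.mulVec) (p : Fin 2 → ℝ)
    {v : Fin 2 → ℝ} (hv : v ≠ 0) : Bornology.IsBounded {t : ℝ | p + t • v ∈ params B ε} := by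
  have hBv : B *ᵥ v ≠ 0 := fun h0 => hv (hB (h0.trans (Matrix.mulVec_zero B).symm))
  refine ((tendsto_add_smul_cobounded hBv (B *ᵥ p)).eventually
    (Bornology.isBounded_def.mp (Metric.isBounded_closedBall (x := 0) (r := 1)))).mono ?_
  intro t ht hparam
  refine ht (mem_closedBall_zero_iff.mpr ((pi_norm_le_iff_of_nonneg zero_le_one).mpr fun i => ?_))
  rw [← Matrix.mulVec_smul, ← Matrix.mulVec_add, ← hparam.2]
  exact Finset.single_le_sum (f := fun i => |(B *ᵥ (p + t • v)) i|) (fun _ _ => abs_nonneg _)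
    (Finset.mem_univ i)

theorem exists_isParamSegment (hB : Function.Injective B.mulVec) (hε : ∀ i, ε i ≠ 0)
    (hne : (params B ε).Nonempty) : ∃ a b p v, IsParamSegment B ε a b p v := by
  obtain ⟨p, hp⟩ := hne
  set σ : Fin 2 → ℝ := (fun i => (ε i : ℝ)) ᵥ* B
  have hσp : cross p (rot σ) = 1 := by
    rw [cross_rot, dotProduct_comm]
    exact (mem_params_iff.mp hp).2
  have hv : rot σ ≠ 0 := fun h0 => by simp [h0, cross] at hσp
  have hσ : ∀ l, cross (rot σ) l = -(σ ⬝ᵥ l) := fun l => by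
    simp only [cross, rot, dotProduct, Fin.sum_univ_two, Matrix.cons_val_zero,
      Matrix.cons_val_one]
    ring
  have hcone : ∀ t : ℝ, p + t • rot σ ∈ params B ε ↔ p + t • rot σ ∈ cone B ε := fun t => by
    rw [mem_params_iff, and_iff_left]
    rw [← neg_inj, ← hσ, cross_add_smul, hσ, (mem_params_iff.mp hp).2]
  have hopen : IsOpen {t : ℝ | p + t • rot σ ∈ params B ε} := by
    simp only [hcone]
    exact (isOpen_cone hε).preimage (by fun_prop)
  have hconv : Convex ℝ {t : ℝ | p + t • rot σ ∈ params B ε} := by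
    simp only [hcone]
    exact ((convex_cone hε).translate_preimage_right p).is_linear_preimage
      (f := fun t : ℝ => t • rot σ) ⟨fun s t => add_smul s t _, fun s t => mul_smul s t _⟩
  obtain ⟨a, b, hab⟩ := exists_eq_Ioo hopen hconv.isPreconnected
    (isBounded_setOf_add_smul_mem_params hB p hv)
  have h0 : (0 : ℝ) ∈ Ioo a b := hab ▸ (by simpa using hp)
  refine ⟨a, b, p, rot σ, h0.1.trans h0.2, hσp, hab ▸ Subset.antisymm (fun l hl => ?_)
    (image_subset_iff.mpr fun t ht => ht)⟩
  obtain ⟨t, rfl⟩ := exists_eq_add_smul_of_cross_eq hv (x := p) (y := l) <| by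
    rw [hσ, hσ, (mem_params_iff.mp hl).2, (mem_params_iff.mp hp).2]
  exact ⟨t, hl, rfl⟩

/-- The velocity of the Horn–Kapranov image of the line of the points `p + t • v`, measured along
the direction `rot (p + t • v)`. -/
noncomputable def xiSpeed (B : Matrix (Fin N) (Fin 2) ℝ) (p v : Fin 2 → ℝ) (t : ℝ) : ℝ :=
  v ⬝ᵥ xiJacobian B (p + t • v) *ᵥ v

namespace IsParamSegment

variable {a b t : ℝ} {p v : Fin 2 → ℝ}

theorem add_smul_mem_params (hP : IsParamSegment B ε a b p v) (ht : t ∈ Ioo a b) :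
    p + t • v ∈ params B ε :=
  hP.params_eq ▸ mem_image_of_mem _ ht

theorem mulVec_ne_zero (hP : IsParamSegment B ε a b p v) (hε : ∀ i, ε i ≠ 0) (ht : t ∈ Ioo a b) :
    ∀ i, (B *ᵥ (p + t • v)) i ≠ 0 :=
  ne_zero_of_mem_orthant hε (hP.add_smul_mem_params ht).1

theorem cross_add_smul_eq_one (hP : IsParamSegment B ε a b p v) (t : ℝ) :
    cross (p + t • v) v = 1 := by
  rw [← hP.cross_eq_one]
  simp only [cross, Pi.add_apply, Pi.smul_apply, smul_eq_mul]
  ring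

theorem injective (hP : IsParamSegment B ε a b p v) :
    Function.Injective fun t : ℝ => p + t • v :=
  add_smul_injective (fun h0 => by simpa [h0, cross] using hP.cross_eq_one) p

theorem isFront (hP : IsParamSegment B ε a b p v) (hB : Bᵀ *ᵥ 1 = 0) (hε : ∀ i, ε i ≠ 0) :
    IsFront a b (fun t => xi B (p + t • v)) (xiSpeed B p v) p v where
  lt := hP.lt
  cross_eq_one := hP.cross_eq_one
  hasDerivAt t ht := by
    have hne := hP.mulVec_ne_zero hε ht
    have hline : HasDerivAt (fun t : ℝ => p + t • v) v t := by
      simpa using ((hasDerivAt_id t).smul_const v).const_add p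
    rw [xiSpeed, ← xiJacobian_mulVec hB hne (hP.cross_add_smul_eq_one t)]
    exact (hasFDerivAt_xi hne).comp_hasDerivAt t hline

theorem fderiv_apply (hP : IsParamSegment B ε a b p v) (hB : Bᵀ *ᵥ 1 = 0) (hε : ∀ i, ε i ≠ 0)
    (ht : t ∈ Ioo a b) (w : Fin 2 → ℝ) : fderiv ℝ (xi B) (p + t • v) w =
      cross (p + t • v) w • deriv (fun t => xi B (p + t • v)) t := by
  have hne := hP.mulVec_ne_zero hε ht
  have hv := hP.cross_add_smul_eq_one t
  rw [(hP.isFront hB hε).deriv_eq ht, xiSpeed, ← xiJacobian_mulVec hB hne hv,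
    (hasFDerivAt_xi hne).fderiv]
  exact linearMap_eq_cross_smul _ (xiJacobian_mulVec_self hB hne) hv w

theorem fderiv_eq_zero_iff (hP : IsParamSegment B ε a b p v) (hB : Bᵀ *ᵥ 1 = 0)
    (hε : ∀ i, ε i ≠ 0) (ht : t ∈ Ioo a b) :
    fderiv ℝ (xi B) (p + t • v) = 0 ↔ xiSpeed B p v t = 0 := by
  rw [← (hP.isFront hB hε).deriv_eq_zero_iff ht]
  refine ⟨fun h0 => ?_, fun h0 => ContinuousLinearMap.ext fun w => ?_⟩
  · simpa [h0, hP.cross_add_smul_eq_one] using (hP.fderiv_apply hB hε ht v).symm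
  · rw [hP.fderiv_apply hB hε ht, h0, smul_zero, zero_apply]

theorem range_fderiv (hP : IsParamSegment B ε a b p v) (hB : Bᵀ *ᵥ 1 = 0) (hε : ∀ i, ε i ≠ 0)
    (ht : t ∈ Ioo a b) : LinearMap.range (fderiv ℝ (xi B) (p + t • v)).toLinearMap =
      Submodule.span ℝ {deriv (fun t => xi B (p + t • v)) t} := by
  ext y
  simp only [LinearMap.mem_range, ContinuousLinearMap.coe_coe, hP.fderiv_apply hB hε ht,
    Submodule.mem_span_singleton]
  refine ⟨fun ⟨w, hw⟩ => ⟨_, hw⟩, fun ⟨r, hr⟩ => ⟨r • v, ?_⟩⟩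
  rw [cross_smul_right, hP.cross_add_smul_eq_one, mul_one, hr]

theorem encard_cusps (hP : IsParamSegment B ε a b p v) (hB : Bᵀ *ᵥ 1 = 0) (hε : ∀ i, ε i ≠ 0) :
    (cusps B ε).encard = {t | t ∈ Ioo a b ∧ xiSpeed B p v t = 0}.encard := by
  have himage : cusps B ε =
      (fun t : ℝ => p + t • v) '' {t | t ∈ Ioo a b ∧ xiSpeed B p v t = 0} := by
    ext l
    rw [cusps, hP.params_eq]
    constructor
    · rintro ⟨⟨t, ht, rfl⟩, h0⟩
      exact ⟨t, ⟨ht, (hP.fderiv_eq_zero_iff hB hε ht).mp h0⟩, rfl⟩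
    · rintro ⟨t, ⟨ht, h0⟩, rfl⟩
      exact ⟨⟨t, ht, rfl⟩, (hP.fderiv_eq_zero_iff hB hε ht).mpr h0⟩
  rw [himage, hP.injective.encard_image]

theorem crossings_eq (hP : IsParamSegment B ε a b p v) (α : ℝ → Fin 2 → ℝ) :
    crossings B ε α = Prod.map id (fun t : ℝ => p + t • v) ''
      pathCrossings (fun t => xi B (p + t • v)) (Ioo a b) α := by
  ext ⟨u, l⟩
  simp only [crossings, pathCrossings, hP.params_eq, mem_ofPred_eq, mem_image, Prod.exists,
    Prod.map_apply, Prod.mk.injEq, id_eq]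
  constructor
  · rintro ⟨hu, ⟨t, ht, rfl⟩, hut⟩
    exact ⟨u, t, ⟨hu, ht, hut⟩, rfl, rfl⟩
  · rintro ⟨u, t, ⟨hu, ht, hut⟩, rfl, rfl⟩
    exact ⟨hu, ⟨t, ht, rfl⟩, hut⟩

theorem isTransversalPath_iff (hP : IsParamSegment B ε a b p v) (hB : Bᵀ *ᵥ 1 = 0)
    (hε : ∀ i, ε i ≠ 0) (α : ℝ → Fin 2 → ℝ) : IsTransversalPath B ε α ↔
      IsTransversal (fun t => xi B (p + t • v)) (Ioo a b) α := by
  rw [IsTransversalPath, hP.crossings_eq, forall_mem_image]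
  refine and_congr_right fun _ => forall₂_congr fun q hq => ?_
  simp only [Prod.map_fst, Prod.map_snd, id_eq, hP.range_fderiv hB hε hq.2.1,
    span_sup_span_eq_top_iff]

-- An open set of parameters of the cone meets the segment of `params B ε` after rescaling.
theorem curveAdjacent [NeZero N] (hP : IsParamSegment B ε a b p v) (hB : Bᵀ *ᵥ 1 = 0)
    (hε : ∀ i, ε i ≠ 0) {C D : Set (Fin 2 → ℝ)} (hadj : Adjacent B ε C D) :
    CurveAdjacent (fun t => xi B (p + t • v)) (Ioo a b) C D := by
  obtain ⟨hCD, V, hV, ⟨l, hl⟩, hVcone, hVCD⟩ := hadj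
  obtain ⟨r, hr, hrl⟩ := exists_smul_mem_params hε (hVcone hl)
  rw [hP.params_eq] at hrl
  obtain ⟨t₀, ht₀, hrl⟩ := hrl
  refine ⟨hCD, Ioo a b ∩ {t | r⁻¹ • (p + t • v) ∈ V}, inter_subset_left,
    isOpen_Ioo.inter (hV.preimage (by fun_prop)), ⟨t₀, ht₀, ?_⟩, ?_⟩
  · change r⁻¹ • (p + t₀ • v) ∈ V
    rwa [show p + t₀ • v = r • l from hrl, inv_smul_smul₀ hr.ne']
  · rintro _ ⟨t, ⟨ht, htV⟩, rfl⟩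
    exact hVCD ⟨_, htV, xi_smul hB hε (hP.add_smul_mem_params ht).1 (inv_pos.mpr hr)⟩

end IsParamSegment

end HornKapranov

section Discriminant

variable {n : ℕ} {A : Fin (n + 3) → Fin n → ℝ} {B : Matrix (Fin (n + 3)) (Fin 2) ℝ}
  {ε : Fin (n + 3) → SignType}

theorem transpose_hat_mulVec_cons (s : ℝ) (x : Fin n → ℝ) :
    (hat A)ᵀ *ᵥ (Fin.cons s x : Fin (n + 1) → ℝ) = fun i => s + A i ⬝ᵥ x := by
  ext i
  simp [hat, Matrix.mulVec, dotProduct, Fin.sum_univ_succ]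

theorem hasFDerivAt_expSum (A : Fin (n + 3) → Fin n → ℝ) (c : Fin (n + 3) → ℝ) (x : Fin n → ℝ) :
    HasFDerivAt (expSum A c) (∑ i, c i • (Real.exp (A i ⬝ᵥ x) •
      (LinearMap.toContinuousLinearMap (dotProductBilin ℝ ℝ (A i))))) x := by
  refine HasFDerivAt.fun_sum fun i _ => HasFDerivAt.const_mul (HasFDerivAt.exp ?_) (c i)
  exact (LinearMap.toContinuousLinearMap (dotProductBilin ℝ ℝ (A i))).hasFDerivAt

theorem isSingularZero_expSum_iff {c : Fin (n + 3) → ℝ} {x : Fin n → ℝ} :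
    IsSingularZero (expSum A c) x ↔ hat A *ᵥ (c * fun i => Real.exp (A i ⬝ᵥ x)) = 0 := by
  rw [IsSingularZero, (hasFDerivAt_expSum A c x).fderiv, funext_iff, Fin.forall_fin_succ]
  refine and_congr (by simp [expSum, hat, Matrix.mulVec, dotProduct]) (forall_congr' fun j => ?_)
  simp only [sum_apply, smul_apply, LinearMap.coe_toContinuousLinearMap',
    dotProductBilin_apply_apply, dotProduct_single, smul_eq_mul, mul_one, Pi.zero_apply]
  refine Eq.congr_left (Finset.sum_congr rfl fun i _ => ?_)
  change _ = A i j * (c i * _)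
  ring

namespace IsGaleDual

theorem injective_mulVec (hB : IsGaleDual A B) : Function.Injective B.mulVec :=
  Matrix.mulVec_injective_iff.mpr hB.1

theorem mulVec_eq_zero_iff (hB : IsGaleDual A B) {u : Fin (n + 3) → ℝ} :
    hat A *ᵥ u = 0 ↔ ∃ l, B *ᵥ l = u := by
  rw [← Matrix.mulVecLin_apply, ← LinearMap.mem_ker, ← hB.2, ← Matrix.range_mulVecLin]
  rfl

theorem hat_mul (hB : IsGaleDual A B) : hat A * B = 0 :=
  Matrix.ext_iff_mulVec.mpr fun l => by
    rw [← Matrix.mulVec_mulVec, hB.mulVec_eq_zero_iff.mpr ⟨l, rfl⟩, Matrix.zero_mulVec]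

theorem transpose_mulVec_affine (hB : IsGaleDual A B) (s : ℝ) (x : Fin n → ℝ) :
    (Bᵀ *ᵥ fun i => s + A i ⬝ᵥ x) = 0 := by
  rw [← transpose_hat_mulVec_cons, Matrix.mulVec_mulVec, ← Matrix.transpose_mul, hB.hat_mul,
    Matrix.transpose_zero, Matrix.zero_mulVec]

theorem transpose_mulVec_one (hB : IsGaleDual A B) : Bᵀ *ᵥ 1 = 0 := by
  simpa [← Pi.one_def] using hB.transpose_mulVec_affine 1 0

theorem logMap_mul_exp (hB : IsGaleDual A B) {c : Fin (n + 3) → ℝ} (hc : ∀ i, c i ≠ 0)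
    (x : Fin n → ℝ) : logMap B (c * fun i => Real.exp (A i ⬝ᵥ x)) = logMap B c := by
  have hexp : logMap B (fun i => Real.exp (A i ⬝ᵥ x)) = 0 := by
    simpa [logMap] using hB.transpose_mulVec_affine 0 x
  rw [logMap_mul hc fun i => (Real.exp_pos _).ne', hexp, add_zero]

-- If `x` is a singular zero of `f_c`, then the vector of the terms `cᵢ exp(αᵢ · x)` lies in the
-- kernel of `Â`, so it is `B l` for a parameter `l`; `logMap B` does not see the exponentials.
theorem curve_eq_image_params (hB : IsGaleDual A B) (hε : ∀ i, ε i ≠ 0) :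
    curve A B ε = xi B '' params B ε := by
  apply Subset.antisymm
  · rintro _ ⟨c, ⟨hc, x, hx⟩, rfl⟩
    obtain ⟨l, hl⟩ := hB.mulVec_eq_zero_iff.mp (isSingularZero_expSum_iff.mp hx)
    have hcone : l ∈ cone B ε := fun i => by
      rw [hl, Pi.mul_apply, sign_mul, sign_pos (Real.exp_pos _), mul_one, hc i]
    obtain ⟨r, hr, hmem⟩ := exists_smul_mem_params hε hcone
    refine ⟨r • l, hmem, ?_⟩
    rw [xi_smul hB.transpose_mulVec_one hε hcone hr, xi, hl,
      hB.logMap_mul_exp (ne_zero_of_mem_orthant hε hc)]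
  · rintro _ ⟨l, hl, rfl⟩
    refine ⟨B *ᵥ l, ⟨hl.1, 0, isSingularZero_expSum_iff.mpr ?_⟩, rfl⟩
    exact hB.mulVec_eq_zero_iff.mpr ⟨l, by ext; simp⟩

end IsGaleDual

namespace IsParamSegment

variable {a b : ℝ} {p v : Fin 2 → ℝ}

theorem curve_eq (hP : IsParamSegment B ε a b p v) (hB : IsGaleDual A B) (hε : ∀ i, ε i ≠ 0) :
    curve A B ε = (fun t => xi B (p + t • v)) '' Ioo a b := by
  rw [hB.curve_eq_image_params hε, hP.params_eq, image_image]

theorem depth_eq (hP : IsParamSegment B ε a b p v) (hB : IsGaleDual A B) (hε : ∀ i, ε i ≠ 0)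
    (C : Set (Fin 2 → ℝ)) :
    depth A B ε C = curveDepth (fun t => xi B (p + t • v)) (Ioo a b) C := by
  simp only [depth, curveDepth, hP.curve_eq hB hε,
    hP.isTransversalPath_iff hB.transpose_mulVec_one hε, hP.crossings_eq,
    (Function.injective_id.prodMap hP.injective).encard_image]

end IsParamSegment

theorem depth_eq_zero_of_isOuter {C : Set (Fin 2 → ℝ)} (hC : IsOuter (curve A B ε) C)
    (hcurve : curve A B ε = xi B '' params B ε) : depth A B ε C = 0 := by
  obtain ⟨⟨x, hx, rfl⟩, -⟩ := id hC
  have hxC := mem_connectedComponentIn (F := (curve A B ε)ᶜ) hx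
  have hno : crossings B ε (fun _ => x) = ∅ := eq_empty_of_forall_notMem fun q hq =>
    hx (hcurve ▸ ⟨q.2, hq.2.1, hq.2.2.symm⟩)
  refine nonpos_iff_eq_zero.mp (iInf_le_of_le (fun _ => x) <| iInf_le_of_le
    ⟨continuousOn_const, by simp [hno]⟩ <| iInf_le_of_le hxC <| iInf_le_of_le ⟨_, hC, hxC⟩ ?_)
  rw [hno, encard_empty]

theorem isOuter_empty_of_isChamber {C : Set (Fin 2 → ℝ)} (hC : IsChamber ∅ C) :
    IsOuter ∅ C := by
  refine ⟨hC, ?_⟩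
  obtain ⟨x, -, rfl⟩ := hC
  rw [compl_empty, connectedComponentIn_univ, PreconnectedSpace.connectedComponent_eq_univ]
  exact NormedSpace.unbounded_univ ℝ _

namespace IsGaleDual

variable {C D : Set (Fin 2 → ℝ)} {m : ℕ}

theorem exists_isParamSegment_or_curve_eq_empty (hB : IsGaleDual A B) (hε : ∀ i, ε i ≠ 0) :
    (∃ a b p v, IsParamSegment B ε a b p v) ∨ curve A B ε = ∅ := by
  rcases (params B ε).eq_empty_or_nonempty with hempty | hne
  · exact Or.inr (by rw [hB.curve_eq_image_params hε, hempty, image_empty])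
  · exact Or.inl (exists_isParamSegment hB.injective_mulVec hε hne)

theorem exists_isParamSegment_of_adjacent (hB : IsGaleDual A B) (hε : ∀ i, ε i ≠ 0)
    (hadj : Adjacent B ε C D) : ∃ a b p v, IsParamSegment B ε a b p v := by
  obtain ⟨-, V, -, ⟨l, hl⟩, hVcone, -⟩ := hadj
  obtain ⟨r, -, hr⟩ := exists_smul_mem_params hε (hVcone hl)
  exact exists_isParamSegment hB.injective_mulVec hε ⟨_, hr⟩

theorem depth_le_half (hB : IsGaleDual A B) (hε : ∀ i, ε i ≠ 0)
    (hm : (cusps B ε).encard = m) (hC : IsChamber (curve A B ε) C) :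
    depth A B ε C ≤ ((m / 2 : ℕ) : ℕ∞) := by
  rcases hB.exists_isParamSegment_or_curve_eq_empty hε with ⟨a, b, p, v, hP⟩ | hempty
  · have hB1 := hB.transpose_mulVec_one
    rw [hP.curve_eq hB hε] at hC
    rw [hP.encard_cusps hB1 hε] at hm
    exact hP.depth_eq hB hε C ▸ (hP.isFront hB1 hε).curveDepth_le_half hm hC
  · rw [hempty] at hC
    have hout : IsOuter (curve A B ε) C := hempty ▸ isOuter_empty_of_isChamber hC
    exact (depth_eq_zero_of_isOuter hout (hB.curve_eq_image_params hε)).trans_le zero_le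

theorem one_le_depth (hB : IsGaleDual A B) (hε : ∀ i, ε i ≠ 0) (hC : IsChamber (curve A B ε) C)
    (hout : ¬ IsOuter (curve A B ε) C) : 1 ≤ depth A B ε C := by
  rcases hB.exists_isParamSegment_or_curve_eq_empty hε with ⟨a, b, p, v, hP⟩ | hempty
  · rw [hP.curve_eq hB hε] at hC hout
    exact hP.depth_eq hB hε C ▸ one_le_curveDepth hC hout
  · rw [hempty] at hC hout
    exact absurd (isOuter_empty_of_isChamber hC) hout

theorem depth_add_depth_add_one_le (hB : IsGaleDual A B) (hε : ∀ i, ε i ≠ 0)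
    (hm : (cusps B ε).encard = m) (hC : IsChamber (curve A B ε) C)
    (hD : IsChamber (curve A B ε) D) (hadj : Adjacent B ε C D) :
    depth A B ε C + depth A B ε D + 1 ≤ max m 1 := by
  obtain ⟨a, b, p, v, hP⟩ := hB.exists_isParamSegment_of_adjacent hε hadj
  have hB1 := hB.transpose_mulVec_one
  rw [hP.curve_eq hB hε] at hC hD
  rw [hP.encard_cusps hB1 hε] at hm
  rw [hP.depth_eq hB hε, hP.depth_eq hB hε]
  exact (hP.isFront hB1 hε).curveDepth_add_curveDepth_add_one_le hm hC hD
    (hP.curveAdjacent hB1 hε hadj)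

theorem depth_le_one_of_adjacent_isOuter (hB : IsGaleDual A B) (hε : ∀ i, ε i ≠ 0)
    (hfin : (cusps B ε).Finite) (hC : IsChamber (curve A B ε) C)
    (hD : IsOuter (curve A B ε) D) (hadj : Adjacent B ε C D) : depth A B ε C ≤ 1 := by
  obtain ⟨a, b, p, v, hP⟩ := hB.exists_isParamSegment_of_adjacent hε hadj
  have hB1 := hB.transpose_mulVec_one
  rw [hP.curve_eq hB hε] at hC hD
  rw [← encard_lt_top_iff, hP.encard_cusps hB1 hε, encard_lt_top_iff] at hfin
  exact hP.depth_eq hB hε C ▸ (hP.isFront hB1 hε).curveDepth_le_one_of_curveAdjacent hfin hC hD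
    (hP.curveAdjacent hB1 hε hadj)

end IsGaleDual

end Discriminant

end NearCircuit

theorem mainTheorem2 {n : ℕ} (A : Fin (n + 3) → Fin n → ℝ) (hA : NearCircuit.IsNearCircuit A)
    (B : Matrix (Fin (n + 3)) (Fin 2) ℝ) (hB : NearCircuit.IsGaleDual A B)
    (ε : Fin (n + 3) → SignType) (hε : ∀ i, ε i ≠ 0)
    (m : ℕ) (hm : (NearCircuit.cusps B ε).encard = m) :
    (∀ C, NearCircuit.IsChamber (NearCircuit.curve A B ε) C →
      NearCircuit.depth A B ε C ≤ ((m / 2 : ℕ) : ℕ∞)) ∧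
    (m = 2 ∨ m = 3 → ∀ C, NearCircuit.IsInner (NearCircuit.curve A B ε) C →
      NearCircuit.depth A B ε C = 1) ∧
    (m = 4 →
      (∀ C, NearCircuit.IsChamber (NearCircuit.curve A B ε) C →
        NearCircuit.depth A B ε C ≤ 2) ∧
      (∀ C D, NearCircuit.IsChamber (NearCircuit.curve A B ε) C →
        NearCircuit.IsChamber (NearCircuit.curve A B ε) D →
        NearCircuit.depth A B ε C = 2 → NearCircuit.Adjacent B ε C D →
        NearCircuit.depth A B ε D = 1)) := by
  refine ⟨fun C hC => hB.depth_le_half hε hm hC, fun hm23 C hC => le_antisymm ?_ ?_, ?_⟩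
  · rcases hm23 with rfl | rfl <;> exact hB.depth_le_half hε hm hC.1
  · exact hB.one_le_depth hε hC.1 fun hout => hout.2 hC.2
  · rintro rfl
    refine ⟨fun C hC => hB.depth_le_half hε hm hC, fun C D hC hD hdepth hadj =>
      le_antisymm ?_ (hB.one_le_depth hε hD fun hout => ?_)⟩
    · have hsum := hB.depth_add_depth_add_one_le hε hm hC hD hadj
      rw [hdepth] at hsum
      lift NearCircuit.depth A B ε D to ℕ using
        ne_top_of_le_ne_top (ENat.natCast_ne_top _) (le_add_self.trans (le_self_add.trans hsum))
        with k
      norm_cast at hsum ⊢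
      omega
    · have hle := hB.depth_le_one_of_adjacent_isOuter hε (Set.finite_of_encard_eq_coe hm) hC hout
        hadj
      rw [hdepth] at hle
      norm_num at hle
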